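/- Let $K\subset\mathbb R^n$ be compact, and let $\mathcal M(E)$ denote the Borel probability measures on $E$. For a compactly supported probability measure $\mu$ put $I(\mu)=\iint\log\frac1{|x-y|}\,d\mu(x)\,d\mu(y)\in(-\infty,\infty]$. A set is called log-polar if $I(\mu)=\infty$ for every probability measure $\mu$ on a compact subset of it. Assume that $K$ is not log-polar, and let $Q:K\to(-\infty,\infty]$ be an admissible weight, i.e. $Q$ is lower semicontinuous and $\{x\in K:Q(x)<\infty\}$ is not log-polar. Put $w=e^{-Q}$, $$V_w=\inf_{\mu\in\mathcal M(K)}\iint\log\frac{1}{|x-y|\,w(x)w(y)}\,d\mu(x)\,d\mu(y),\qquad |VDM_k^Q(x_1,\dots,x_k)|=\prod_{i<j}|x_i-x_j|\,w(x_i)w(x_j),$$ $$\delta_k^Q(K)=\sup_{x_1,\dots,x_k\in K}|VDM_k^Q(x_1,\dots,x_k)|^{2/k(k-1)},\qquad Z_k^Q(K,\mu)=\int_{K^k}|VDM_k^Q(x_1,\dots,x_k)|^2\,d\mu(x_1)\cdots d\mu(x_k).$$ Then $V_w$ is finite, the limit $\delta^Q(K):=\lim_{k\to\infty}\delta_k^Q(K)$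 exists, and there is a finite Borel measure $\mu$ on $K$ with $$\lim_{k\to\infty}\bigl(Z_k^Q(K,\mu)\bigr)^{1/k(k-1)}=\exp(-V_w)=\delta^Q(K).$$ Moreover, $\mu$ can be chosen to be, in addition, a strong Bernstein–Markov measure for $K$: for every continuous $q:K\to\mathbb R$ there are constants $M_k\ge 0$ with $\limsup_{k\to\infty}M_k^{1/k}=1$ such that, for all $k\ge1$ and all real polynomials $p$ in $n$ variables of degree at most $k$, $$\sup_{K}|e^{-kq}p|\le M_k\,\Bigl(\int_K|e^{-kq}p|^2\,d\mu\Bigr)^{1/2}.$$ -/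

import Mathlib

open MeasureTheory Filter Topology
open scoped ENNReal NNReal

noncomputable section

namespace LogPotential

variable {n : ℕ}

/-- Integral with values in `[-∞, +∞]`: integral of the positive part minus integral of the negative
part. Below it is only applied to integrands that are bounded from below almost everywhere, against
finite measures, so that the subtracted term is finite. -/
def extIntegral {α : Type*} [MeasurableSpace α] (μ : Measure α) (f : α → EReal) : EReal :=
  ((∫⁻ x, (f x).toENNReal ∂μ : ℝ≥0∞) : EReal) - ((∫⁻ x, (-f x).toENNReal ∂μ : ℝ≥0∞) : EReal)

/-- The Borel probability measures on `K`, seen as measures on `ℝⁿ` carried by `K`. -/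
def probMeasures (K : Set (EuclideanSpace ℝ (Fin n))) :
    Set (Measure (EuclideanSpace ℝ (Fin n))) :=
  {μ | IsProbabilityMeasure μ ∧ μ Kᶜ = 0}

/-- The logarithmic energy `I(μ) = ∬ log (1 / |x - y|) dμ(x) dμ(y)`; the kernel is `+∞` on the
diagonal. -/
def logEnergy (μ : Measure (EuclideanSpace ℝ (Fin n))) : EReal :=
  extIntegral (μ.prod μ) fun z => ENNReal.log (edist z.1 z.2)⁻¹

/-- A set is log-polar if every probability measure on a compact subset of it has infinite
logarithmic energy. For a compact set `K` this says `I(μ) = ∞` for all probability measures `μ` on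
`K`, since a measure on a compact subset of `K` is also a measure on `K`. -/
def IsLogPolar (E : Set (EuclideanSpace ℝ (Fin n))) : Prop :=
  ∀ F ⊆ E, IsCompact F → ∀ μ ∈ probMeasures F, logEnergy μ = ⊤

/-- `Q` is an admissible weight on `K`: it takes values in `(-∞, +∞]` on `K`, is lower
semicontinuous on `K`, and is finite on a non log-polar subset of `K`.
Only the values of `Q` on `K` matter. -/
structure IsAdmissible (K : Set (EuclideanSpace ℝ (Fin n)))
    (Q : EuclideanSpace ℝ (Fin n) → EReal) : Prop where
  ne_bot : ∀ x ∈ K, Q x ≠ ⊥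
  lsc : LowerSemicontinuousOn Q K
  not_logPolar : ¬ IsLogPolar {x ∈ K | Q x < ⊤}

/-- `w = e^{-Q}`, with values in `[0, ∞]` (finite where `Q > -∞`). -/
def weight (Q : EuclideanSpace ℝ (Fin n) → EReal) (x : EuclideanSpace ℝ (Fin n)) : ℝ≥0∞ :=
  EReal.exp (-Q x)

/-- The weighted energy `I^Q(μ) = ∬ log (1 / (|x - y| w(x) w(y))) dμ(x) dμ(y)`. -/
def weightedEnergy (Q : EuclideanSpace ℝ (Fin n) → EReal)
    (μ : Measure (EuclideanSpace ℝ (Fin n))) : EReal :=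
  extIntegral (μ.prod μ) fun z =>
    ENNReal.log (edist z.1 z.2 * weight Q z.1 * weight Q z.2)⁻¹

/-- The minimal weighted energy `V_w`, the infimum of `I^Q(μ)` over the probability measures `μ`
on `K`. -/
def minEnergy (K : Set (EuclideanSpace ℝ (Fin n))) (Q : EuclideanSpace ℝ (Fin n) → EReal) :
    EReal :=
  ⨅ μ ∈ probMeasures K, weightedEnergy Q μ

/-- The absolute value of the weighted Vandermonde, `∏_{i < j} |x_i - x_j| w(x_i) w(x_j)`. -/
def weightedVDM (Q : EuclideanSpace ℝ (Fin n) → EReal) {k : ℕ}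
    (x : Fin k → EuclideanSpace ℝ (Fin n)) : ℝ≥0∞ :=
  ∏ i, ∏ j ∈ Finset.Ioi i, edist (x i) (x j) * weight Q (x i) * weight Q (x j)

/-- The `k`-th weighted diameter
`δ_k^Q(K) = sup_{x_1, …, x_k ∈ K} |VDM_k^Q(x_1, …, x_k)|^{2 / (k (k - 1))}`, for `k ≥ 2`. -/
def weightedDiameter (K : Set (EuclideanSpace ℝ (Fin n)))
    (Q : EuclideanSpace ℝ (Fin n) → EReal) (k : ℕ) : ℝ≥0∞ :=
  ⨆ x ∈ Set.univ.pi fun _ : Fin k => K, weightedVDM Q x ^ (2 / ((k : ℝ) * ((k : ℝ) - 1)))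

/-- The normalization constant `Z_k^Q(K, ν) = ∫_{K^k} |VDM_k^Q(x_1, …, x_k)|² dν(x_1) ⋯ dν(x_k)`. -/
def partitionZ (K : Set (EuclideanSpace ℝ (Fin n))) (Q : EuclideanSpace ℝ (Fin n) → EReal)
    (ν : Measure (EuclideanSpace ℝ (Fin n))) (k : ℕ) : ℝ≥0∞ :=
  ∫⁻ x in Set.univ.pi fun _ : Fin k => K, weightedVDM Q x ^ 2 ∂(Measure.pi fun _ : Fin k => ν)

/-- The weighted Bernstein-Markov property of `(K, ν, Q)`: there are constants `M_k` with
`limsup M_k^{1/k} = 1` such that `‖e^{-kQ} p‖_K ≤ M_k ‖e^{-kQ} p‖_{L²(ν)}` for every `k ≥ 1` and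
every real polynomial `p` of degree at most `k` in `n` variables. -/
def WeightedBernsteinMarkov (K : Set (EuclideanSpace ℝ (Fin n)))
    (ν : Measure (EuclideanSpace ℝ (Fin n))) (Q : EuclideanSpace ℝ (Fin n) → EReal) : Prop :=
  ∃ M : ℕ → ℝ≥0,
    limsup (fun k : ℕ => (M k : ℝ≥0∞) ^ (1 / (k : ℝ))) atTop = 1 ∧
    ∀ k : ℕ, 1 ≤ k → ∀ p : MvPolynomial (Fin n) ℝ, p.totalDegree ≤ k →
      (⨆ x ∈ K, weight Q x ^ k * ‖MvPolynomial.eval (fun i => x i) p‖ₑ) ≤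
        M k * (∫⁻ x in K, (weight Q x ^ k * ‖MvPolynomial.eval (fun i => x i) p‖ₑ) ^ 2 ∂ν)
          ^ (1 / 2 : ℝ)

/-- `ν` is a strong Bernstein-Markov measure for `K`: it is a finite measure on `K`, and the
weighted Bernstein-Markov property holds for every continuous (real-valued) weight on `K`. -/
structure IsStrongBernsteinMarkov (K : Set (EuclideanSpace ℝ (Fin n)))
    (ν : Measure (EuclideanSpace ℝ (Fin n))) : Prop where
  finite : IsFiniteMeasure ν
  carried : ν Kᶜ = 0
  bernsteinMarkov : ∀ q : EuclideanSpace ℝ (Fin n) → ℝ, ContinuousOn q K →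
    WeightedBernsteinMarkov K ν fun x => (q x : EReal)

end LogPotential

end

/-! On K one has |x-y| w(x) w(y) = A e^{-h(x,y)} with a constant A < ∞ and a symmetric lower
semicontinuous h ≥ 0 (`edist_mul_weight_mul_weight`). Weighted energies thus become integrals of h
minus log A. By weak compactness some σ minimizes the h-energy (`exists_minimal_energy`); with
minimum J, e^{-V_w} = A e^{-J}. Admissibility makes J finite.

Jensen's inequality for the k-fold product of σ gives Z_k(ν) ≥ (A e^{-J})^{k(k-1)} whenever ν ≥ σ
(`le_partitionZ`), while trivially Z_k(ν) ≤ δ_k^{k(k-1)} ν(K)^k. Conversely, configurations with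
mean pair energy below J - η for infinitely many k would have empirical measures with a weak limit
of energy below J (`exists_energy_le_of_frequently_pairSum_le`), which is impossible. Hence δ_k and
Z_k^{1/k(k-1)} both tend to A e^{-J}, for every finite ν ≥ σ and without any Bernstein-Markov
property.

It remains to add to σ a strong Bernstein-Markov measure, since both properties survive the
addition. A weighted sum of point masses at Fekete points of all degrees has a polynomial
Bernstein-Markov inequality (`exists_measure_bernsteinMarkov`). For continuous q, approximate e^{-q}
by a real polynomial f up to a factor 1+ε and apply that inequality to f^k p, of degree O(k). -/

section MeasureTheoryLemmas

/-! ### Lower semicontinuous energies and weak limits. -/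

/-- Products of measures are monotone in the factors. -/
theorem MeasureTheory.Measure.pi_mono_of_le {ι : Type*} [Fintype ι] {α : ι → Type*}
    [∀ i, MeasurableSpace (α i)] {μ ν : ∀ i, Measure (α i)} [∀ i, SigmaFinite (μ i)]
    (h : ∀ i, μ i ≤ ν i) : Measure.pi μ ≤ Measure.pi ν := by
  refine Measure.le_iff.2 fun s hs => ?_
  -- The product outer measure is the largest one bounded by the products on boxes, so boxes
  -- suffice.
  have h1 : (Measure.pi μ).toOuterMeasure ≤ OuterMeasure.pi fun i => (ν i).toOuterMeasure := by
    refine OuterMeasure.le_pi.2 fun t _ => ?_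
    rw [Measure.coe_toOuterMeasure, Measure.pi_pi]
    exact Finset.prod_le_prod' fun i _ => h i (t i)
  rw [Measure.pi_def ν, toMeasure_apply _ _ hs]
  exact h1 s

/-- For bounded lower semicontinuous functions the integral is lower semicontinuous with respect to
weak convergence. -/
theorem lintegral_le_liminf_of_lowerSemicontinuous {X : Type*} [TopologicalSpace X]
    [MeasurableSpace X] [BorelSpace X] [HasOuterApproxClosed X]
    {μ : ProbabilityMeasure X} {μs : ℕ → ProbabilityMeasure X} (hμ : Tendsto μs atTop (𝓝 μ))
    {f : X → ℝ≥0∞} (hf : LowerSemicontinuous f) (hfin : ∀ x, f x ≠ ⊤) :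
    ∫⁻ x, f x ∂(μ : Measure X) ≤ liminf (fun i => ∫⁻ x, f x ∂(μs i : Measure X)) atTop := by
  have hlevel : ∀ t : ℝ, 0 ≤ t → {a | t < (f a).toReal} = f ⁻¹' Set.Ioi (ENNReal.ofReal t) := by
    intro t ht
    ext a
    simp [ENNReal.ofReal_lt_iff_lt_toReal ht (hfin a)]
  -- Layer cake: the superlevel sets are open, so the portmanteau inequality applies at each level
  -- and Fatou integrates over the levels.
  have key : ∀ ν : Measure X, ∫⁻ x, f x ∂ν =
      ∫⁻ t in Set.Ioi (0 : ℝ), ν (f ⁻¹' Set.Ioi (ENNReal.ofReal t)) := by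
    intro ν
    have := lintegral_eq_lintegral_meas_lt ν (f := fun x => (f x).toReal)
      (Eventually.of_forall fun x => ENNReal.toReal_nonneg)
      hf.measurable.ennreal_toReal.aemeasurable
    simp only [ENNReal.ofReal_toReal (hfin _)] at this
    rw [this]
    refine setLIntegral_congr_fun measurableSet_Ioi fun t ht => ?_
    simp only [hlevel t (le_of_lt ht)]
  simp_rw [key]
  refine (lintegral_mono fun t => ?_).trans (lintegral_liminf_le fun i => ?_)
  · exact ProbabilityMeasure.le_liminf_measure_open_of_tendsto hμ (hf.isOpen_preimage _)
  · refine Antitone.measurable fun s t hst => measure_mono fun a ha => ?_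
    exact lt_of_le_of_lt (ENNReal.ofReal_le_ofReal hst) ha

/-- Jensen's inequality for `t ↦ e^{-t}`. -/
theorem exp_neg_lintegral_le {Ω : Type*} [MeasurableSpace Ω] (P : Measure Ω)
    [IsProbabilityMeasure P] {G : Ω → ℝ≥0∞} (hG : Measurable G) :
    EReal.exp (-((∫⁻ x, G x ∂P : ℝ≥0∞) : EReal)) ≤ ∫⁻ x, EReal.exp (-(G x : EReal)) ∂P := by
  by_cases htop : ∫⁻ x, G x ∂P = ⊤
  · simp [htop]
  obtain ⟨m, hm⟩ : ∃ m : ℝ≥0, ∫⁻ x, G x ∂P = m := ⟨_, (ENNReal.coe_toNNReal htop).symm⟩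
  rw [hm] at htop ⊢
  set c := EReal.exp (-((m : ℝ≥0∞) : EReal)) with hc
  -- Tangent line of e^{-t} at the mean m, with the negative term moved across to stay in [0, ∞].
  have hpt : ∀ t : ℝ≥0∞, c * (1 + m) ≤ EReal.exp (-(t : EReal)) + c * t := by
    intro t
    have hc0 : c ≠ 0 := by simp [hc, htop]
    induction t with
    | top => simp [ENNReal.mul_top hc0]
    | coe t =>
      have hc' : c = ENNReal.ofReal (Real.exp (-m)) := rfl
      have ht' : EReal.exp (-((t : ℝ≥0∞) : EReal)) = ENNReal.ofReal (Real.exp (-t)) := rfl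
      rw [hc', ht', ← ENNReal.ofReal_coe_nnreal, ← ENNReal.ofReal_coe_nnreal, ← ENNReal.ofReal_one,
        ← ENNReal.ofReal_add (by positivity) (by positivity),
        ← ENNReal.ofReal_mul (by positivity), ← ENNReal.ofReal_mul (by positivity),
        ← ENNReal.ofReal_add (by positivity) (by positivity)]
      refine ENNReal.ofReal_le_ofReal ?_
      have h1 := Real.add_one_le_exp ((m : ℝ) - t)
      have h2 : Real.exp (-(t : ℝ)) = Real.exp (-m) * Real.exp (m - t) := by
        rw [← Real.exp_add]; ring_nf
      rw [h2]
      nlinarith [Real.exp_pos (-(m : ℝ))]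
  have hcfin : c ≠ ⊤ := by simp [hc, EReal.neg_eq_top_iff]
  have hint := lintegral_mono (μ := P) fun x => hpt (G x)
  rw [lintegral_add_right _ (hG.const_mul c), lintegral_const_mul _ hG, hm] at hint
  simp only [lintegral_const, measure_univ, mul_one] at hint
  rw [mul_add, mul_one] at hint
  exact (ENNReal.add_le_add_iff_right (ENNReal.mul_ne_top hcfin htop)).1 hint

/-- Compactness principle: if the energies of probability measures carried by a compact set
for all truncations of a lower semicontinuous kernel are asymptotically at most `a`, then some
probability measure carried by this set has energy at most `a`. -/
theorem exists_energy_le_of_limsup_le {X : Type*} [MetricSpace X] [SecondCountableTopology X]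
    [MeasurableSpace X] [BorelSpace X]
    {K : Set X} (hK : IsCompact K) {h : X × X → ℝ≥0∞}
    (hh : LowerSemicontinuous h) {a : ℝ≥0∞} (μ : ℕ → Measure X)
    (hμ : ∀ k, IsProbabilityMeasure (μ k)) (hμK : ∀ k, μ k Kᶜ = 0)
    (hlim : ∀ M : ℕ, limsup (fun k => ∫⁻ z, min (h z) M ∂((μ k).prod (μ k))) atTop ≤ a) :
    ∃ σ : Measure X, IsProbabilityMeasure σ ∧ σ Kᶜ = 0 ∧ ∫⁻ z, h z ∂(σ.prod σ) ≤ a := by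
  let P : ℕ → ProbabilityMeasure X := fun k => ⟨μ k, hμ k⟩
  -- Prokhorov compactness for a tight family, with the same compact set and tolerance 0 at every
  -- index.
  have hcpt : IsCompact {ν : ProbabilityMeasure X | ∀ _ : ℕ, ν Kᶜ ≤ (0 : ℝ≥0)} :=
    isCompact_setOfPred_probabilityMeasure_mass_eq_compl_isCompact_le (u := fun _ => 0)
      (K := fun _ => K) tendsto_const_nhds (fun _ => hK) (Or.inr monotone_const)
  have hmem : ∀ k, P k ∈ {ν : ProbabilityMeasure X | ∀ _ : ℕ, ν Kᶜ ≤ (0 : ℝ≥0)} := by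
    intro k _
    simp [P, ProbabilityMeasure.mk_apply, hμK k]
  obtain ⟨σ, hσ, φ, hφ, hconv⟩ := hcpt.tendsto_subseq hmem
  refine ⟨σ, inferInstance, ?_, ?_⟩
  · have := hσ 0
    rw [nonpos_iff_eq_zero] at this
    exact (ProbabilityMeasure.null_iff_toMeasure_null _ _).1 this
  have hconv2 : Tendsto (fun k => (P (φ k)).prod (P (φ k))) atTop (𝓝 (σ.prod σ)) :=
    (ProbabilityMeasure.continuous_prod.tendsto (σ, σ)).comp (hconv.prodMk_nhds hconv)
  -- Truncation makes the kernel finite-valued, as the semicontinuity lemma needs; monotone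
  -- convergence removes it below.
  have htrunc : ∀ M : ℕ, ∫⁻ z, min (h z) M ∂((σ : Measure X).prod σ) ≤ a := by
    intro M
    have hlsc : LowerSemicontinuous fun z => min (h z) (M : ℝ≥0∞) :=
      hh.inf lowerSemicontinuous_const
    have h1 := lintegral_le_liminf_of_lowerSemicontinuous hconv2 hlsc fun z =>
      ne_top_of_le_ne_top (ENNReal.natCast_ne_top M) (min_le_right _ _)
    refine h1.trans ((liminf_le_limsup).trans (le_trans ?_ (hlim M)))
    exact limsup_le_limsup_of_le (u := fun k => ∫⁻ z, min (h z) M ∂((μ k).prod (μ k)))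
      hφ.tendsto_atTop
  have hsup : ∀ z, h z = ⨆ M : ℕ, min (h z) (M : ℝ≥0∞) := by
    intro z
    rw [← inf_iSup_eq, ENNReal.iSup_natCast, inf_top_eq]
  rw [lintegral_congr hsup]
  rw [lintegral_iSup (fun M => hh.measurable.min measurable_const)
    (fun M N hMN z => min_le_min le_rfl (by exact_mod_cast hMN))]
  exact iSup_le htrunc

/-! ### Discrete energies and empirical measures. -/

/-- The discrete energy of a configuration of points, the sum over the pairs. -/
noncomputable def pairSum {X : Type*} (h : X × X → ℝ≥0∞) {k : ℕ} (x : Fin k → X) : ℝ≥0∞ :=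
  ∑ i, ∑ j ∈ Finset.Ioi i, h (x i, x j)

/-- The number of pairs `i < j` in `Fin k`. -/
def numPairs (k : ℕ) : ℕ := ∑ i : Fin k, (Finset.Ioi i).card

theorem two_mul_numPairs (k : ℕ) : 2 * numPairs k = k * (k - 1) := by
  have : numPairs k = ∑ i ∈ Finset.range k, i := by
    rw [numPairs, ← Finset.sum_range_reflect, Finset.sum_range]
    refine Finset.sum_congr rfl fun i _ => ?_
    rw [Fin.card_Ioi]
  rw [this, mul_comm, Finset.sum_range_id_mul_two]

theorem sum_sum_eq_diag_add_pairSum {X : Type*} {h : X × X → ℝ≥0∞}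
    (hsymm : ∀ x y, h (x, y) = h (y, x)) {k : ℕ} (x : Fin k → X) :
    ∑ i, ∑ j, h (x i, x j) = (∑ i, h (x i, x i)) + 2 * pairSum h x := by
  have h1 : ∀ i : Fin k, ∑ j, h (x i, x j) =
      h (x i, x i) + ∑ j ∈ Finset.Ioi i, h (x i, x j) + ∑ j ∈ Finset.Iio i, h (x i, x j) := by
    intro i
    have : (Finset.univ : Finset (Fin k)) = (insert i (Finset.Ioi i)) ∪ Finset.Iio i := by
      ext j; simp; grind
    rw [this, Finset.sum_union, Finset.sum_insert (by simp)]
    rw [Finset.disjoint_left]; intro j; simp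
  have h2 : ∑ i : Fin k, ∑ j ∈ Finset.Iio i, h (x i, x j) = pairSum h x := by
    rw [pairSum, Finset.sum_comm' (t' := Finset.univ) (s' := fun j => Finset.Ioi j)]
    · exact Finset.sum_congr rfl fun i _ => Finset.sum_congr rfl fun j _ => hsymm _ _
    · intro i j; simp
  simp_rw [h1]
  rw [Finset.sum_add_distrib, Finset.sum_add_distrib, h2, two_mul, add_assoc]
  rfl

/-- The normalized counting measure of a configuration of points. -/
noncomputable def empiricalMeasure {X : Type*} [MeasurableSpace X] {k : ℕ} (x : Fin k → X) :
    Measure X :=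
  (k : ℝ≥0∞)⁻¹ • ∑ i, Measure.dirac (x i)

theorem lintegral_empiricalMeasure {X : Type*} [MeasurableSpace X] {k : ℕ} (x : Fin k → X)
    {f : X → ℝ≥0∞} (hf : Measurable f) :
    ∫⁻ y, f y ∂(empiricalMeasure x) = (k : ℝ≥0∞)⁻¹ * ∑ i, f (x i) := by
  simp [empiricalMeasure, lintegral_smul_measure, lintegral_finsetSum_measure, lintegral_dirac' _ hf]

/-- If infinitely many configurations of points of a compact set have mean pair energy at most `a`,
then some probability measure on this set has energy at most `a`. -/
theorem exists_energy_le_of_frequently_pairSum_le {X : Type*} [MetricSpace X]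
    [SecondCountableTopology X] [MeasurableSpace X] [BorelSpace X]
    {K : Set X} (hK : IsCompact K)
    {h : X × X → ℝ≥0∞} (hh : LowerSemicontinuous h) (hsymm : ∀ x y, h (x, y) = h (y, x))
    {a : ℝ≥0∞}
    (hfreq : ∃ᶠ k in atTop, ∃ x : Fin k → X, (∀ i, x i ∈ K) ∧ pairSum h x ≤ numPairs k * a) :
    ∃ σ : Measure X, IsProbabilityMeasure σ ∧ σ Kᶜ = 0 ∧ ∫⁻ z, h z ∂(σ.prod σ) ≤ a := by
  obtain ⟨φ, hφ, hφx⟩ := extraction_of_frequently_atTop (hfreq.and_eventually (eventually_ge_atTop 1))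
  choose hx hφ1 using hφx
  choose x hxK hxa using hx
  have hne : ∀ k, ((φ k : ℕ) : ℝ≥0∞) ≠ 0 := fun k => by
    have := hφ1 k; simp; omega
  refine exists_energy_le_of_limsup_le hK hh (fun k => empiricalMeasure (x k)) ?_ ?_ ?_
  · intro k
    constructor
    have := lintegral_empiricalMeasure (x k) (f := fun _ => 1) measurable_const
    simp only [lintegral_const, one_mul] at this
    rw [this]
    simp [ENNReal.inv_mul_cancel (hne k) (ENNReal.natCast_ne_top _)]
  · intro k
    have hKm := hK.measurableSet.compl
    simp only [empiricalMeasure, Measure.smul_apply, Measure.finsetSum_apply,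
      Measure.dirac_apply' _ hKm, smul_eq_mul]
    simp [hxK]
  intro M
  have hmeas : Measurable fun z => min (h z) (M : ℝ≥0∞) := hh.measurable.min measurable_const
  -- The diagonal, where h may be infinite, costs at most kM/k² = M/k after truncation; the k(k-1)
  -- off-diagonal terms contribute at most a.
  have hbound : ∀ k, ∫⁻ z, min (h z) M ∂((empiricalMeasure (x k)).prod (empiricalMeasure (x k))) ≤
      M * ((φ k : ℕ) : ℝ≥0∞)⁻¹ + a := by
    intro k
    have hsf : SFinite (empiricalMeasure (x k)) := by unfold empiricalMeasure; infer_instance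
    rw [lintegral_prod _ hmeas.aemeasurable, lintegral_empiricalMeasure _ hmeas.lintegral_prod_right']
    have : ∀ i, ∫⁻ y, min (h (x k i, y)) M ∂(empiricalMeasure (x k)) =
        ((φ k : ℕ) : ℝ≥0∞)⁻¹ * ∑ j, min (h (x k i, x k j)) M := fun i =>
      lintegral_empiricalMeasure _ (hmeas.comp measurable_prodMk_left)
    simp_rw [this]
    rw [← Finset.mul_sum,
      sum_sum_eq_diag_add_pairSum (h := fun z => min (h z) M) (fun y z => by simp [hsymm y z])]
    set N := φ k
    have h1 : ∑ i, min (h (x k i, x k i)) (M : ℝ≥0∞) ≤ N * M := by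
      refine (Finset.sum_le_sum fun i _ => min_le_right _ _).trans ?_
      simp [N]
    have h2 : 2 * pairSum (fun z => min (h z) (M : ℝ≥0∞)) (x k) ≤ N * (N * a) := by
      have h3 : pairSum (fun z => min (h z) (M : ℝ≥0∞)) (x k) ≤ numPairs N * a :=
        (Finset.sum_le_sum fun i _ => Finset.sum_le_sum fun j _ => min_le_left _ _).trans (hxa k)
      calc _ ≤ 2 * (numPairs N * a) := by gcongr
        _ = ((2 * numPairs N : ℕ) : ℝ≥0∞) * a := by push_cast; ring
        _ ≤ ((N * N : ℕ) : ℝ≥0∞) * a := by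
          refine mul_le_mul_left (Nat.cast_le.2 ?_) _
          rw [two_mul_numPairs]
          exact Nat.mul_le_mul_left _ (Nat.sub_le _ _)
        _ = _ := by push_cast; ring
    have hinv : (N : ℝ≥0∞)⁻¹ * N = 1 := ENNReal.inv_mul_cancel (hne k) (ENNReal.natCast_ne_top _)
    calc _ ≤ (N : ℝ≥0∞)⁻¹ * ((N : ℝ≥0∞)⁻¹ * (N * M + N * (N * a))) := by gcongr
      _ = ((N : ℝ≥0∞)⁻¹ * N) * (M * (N : ℝ≥0∞)⁻¹ + ((N : ℝ≥0∞)⁻¹ * N) * a) := by ring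
      _ = _ := by rw [hinv, one_mul, one_mul]
  have hlim : Tendsto (fun k => (M : ℝ≥0∞) * ((φ k : ℕ) : ℝ≥0∞)⁻¹ + a) atTop (𝓝 (M * 0 + a)) := by
    refine Tendsto.add (ENNReal.Tendsto.const_mul ?_ (Or.inr (ENNReal.natCast_ne_top _)))
      tendsto_const_nhds
    exact ENNReal.tendsto_inv_nat_nhds_zero.comp hφ.tendsto_atTop
  refine (limsup_le_limsup (Eventually.of_forall hbound)).trans ?_
  rw [hlim.limsup_eq]
  simp

/-- A minimizer of the energy of a lower semicontinuous kernel on a compact set. -/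
theorem exists_minimal_energy {X : Type*} [MetricSpace X] [SecondCountableTopology X]
    [MeasurableSpace X] [BorelSpace X]
    {K : Set X} (hK : IsCompact K) (hne : K.Nonempty)
    {h : X × X → ℝ≥0∞} (hh : LowerSemicontinuous h) :
    ∃ σ : Measure X, IsProbabilityMeasure σ ∧ σ Kᶜ = 0 ∧
      ∀ μ : Measure X, IsProbabilityMeasure μ → μ Kᶜ = 0 →
        ∫⁻ z, h z ∂(σ.prod σ) ≤ ∫⁻ z, h z ∂(μ.prod μ) := by
  let S : Set ℝ≥0∞ := (fun μ : Measure X => ∫⁻ z, h z ∂(μ.prod μ)) ''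
    {μ | IsProbabilityMeasure μ ∧ μ Kᶜ = 0}
  have hS : S.Nonempty := by
    obtain ⟨x, hx⟩ := hne
    refine ⟨_, Measure.dirac x, ⟨inferInstance, ?_⟩, rfl⟩
    rw [Measure.dirac_apply' _ hK.measurableSet.compl]; simp [hx]
  obtain ⟨u, -, hu, huS⟩ := exists_seq_tendsto_sInf hS (OrderBot.bddBelow S)
  choose μ hμ hμu using huS
  obtain ⟨σ, h1, h2, h3⟩ := exists_energy_le_of_limsup_le hK hh (a := sInf S) μ
    (fun k => (hμ k).1) (fun k => (hμ k).2) fun M => by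
      rw [← hu.limsup_eq]
      refine limsup_le_limsup (Eventually.of_forall fun k => ?_)
      simp only [← hμu k]
      exact lintegral_mono fun z => min_le_left _ _
  exact ⟨σ, h1, h2, fun μ hμ1 hμ2 => h3.trans (sInf_le ⟨μ, ⟨hμ1, hμ2⟩, rfl⟩)⟩

end MeasureTheoryLemmas

/-! ### Weighted energies as integrals of a nonnegative kernel. -/

section WeightedEnergies

open LogPotential

/-- `e^{-t}`, for `t ∈ [0, ∞]`. -/
noncomputable def expNeg (t : ℝ≥0∞) : ℝ≥0∞ := EReal.exp (-(t : EReal))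

theorem expNeg_zero : expNeg 0 = 1 := by simp [expNeg]

theorem expNeg_add (s t : ℝ≥0∞) : expNeg (s + t) = expNeg s * expNeg t := by
  rw [expNeg, EReal.coe_ennreal_add, EReal.neg_add (by simp) (by simp), sub_eq_add_neg,
    EReal.exp_add]
  rfl

theorem expNeg_sum {ι : Type*} (s : Finset ι) (f : ι → ℝ≥0∞) :
    expNeg (∑ i ∈ s, f i) = ∏ i ∈ s, expNeg (f i) := by
  classical
  induction s using Finset.induction_on with
  | empty => simp [expNeg_zero]
  | insert a s ha ih => rw [Finset.sum_insert ha, Finset.prod_insert ha, expNeg_add, ih]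

theorem expNeg_antitone : Antitone expNeg := fun s t hst => by
  simpa [expNeg] using hst

theorem expNeg_ne_top (t : ℝ≥0∞) : expNeg t ≠ ⊤ := by
  simp [expNeg, EReal.neg_eq_top_iff]

theorem continuous_expNeg : Continuous expNeg :=
  ENNReal.continuous_exp.comp (continuous_neg.comp continuous_coe_ennreal_ereal)

theorem expNeg_pow (t : ℝ≥0∞) (m : ℕ) : expNeg t ^ m = expNeg (m * t) := by
  have := expNeg_sum (Finset.range m) fun _ => t
  simpa using this.symm

/-- The negative part of h - L is at most L, so its integral is finite and the subtraction is
harmless even if h has infinite integral. -/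
theorem extIntegral_sub_const {α : Type*} [MeasurableSpace α] (P : Measure α)
    [IsProbabilityMeasure P] {h : α → ℝ≥0∞} (hh : Measurable h) {L : ℝ} (hL : 0 ≤ L)
    {f : α → EReal} (hf : ∀ᵐ x ∂P, f x = (h x : EReal) - L) :
    extIntegral P f = ((∫⁻ x, h x ∂P : ℝ≥0∞) : EReal) - L := by
  -- The identity (t-L)⁺ + L = t + (t-L)⁻, free of subtraction between integrals.
  have hpt : ∀ t : ℝ≥0∞, ((t : EReal) - L).toENNReal + ENNReal.ofReal L =
      t + (-((t : EReal) - L)).toENNReal ∧ (-((t : EReal) - L)).toENNReal ≤ ENNReal.ofReal L := by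
    intro t
    induction t with
    | top => simp
    | coe t =>
      have h1 : (((t : ℝ≥0∞) : EReal) - L) = (((t : ℝ) - L : ℝ) : EReal) := rfl
      have h2 : -(((t : ℝ≥0∞) : EReal) - L) = ((L - (t : ℝ) : ℝ) : EReal) := by
        rw [h1, ← EReal.coe_neg]; simp
      rw [h2, h1, EReal.toENNReal_of_ne_top (EReal.coe_ne_top _),
        EReal.toENNReal_of_ne_top (EReal.coe_ne_top _), EReal.toReal_coe, EReal.toReal_coe]
      refine ⟨?_, ENNReal.ofReal_le_ofReal (by simp)⟩
      rcases le_total L t with h | h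
      · rw [ENNReal.ofReal_of_nonpos (sub_nonpos.2 h), add_zero,
          ← ENNReal.ofReal_add (sub_nonneg.2 h) hL]
        simp
      · rw [ENNReal.ofReal_of_nonpos (sub_nonpos.2 h), zero_add, ← ENNReal.ofReal_coe_nnreal (p := t),
          ← ENNReal.ofReal_add t.coe_nonneg (sub_nonneg.2 h)]
        simp
  have hm : Measurable fun x => (-((h x : EReal) - L)).toENNReal := by fun_prop
  set A := ∫⁻ x, ((h x : EReal) - L).toENNReal ∂P
  set B := ∫⁻ x, (-((h x : EReal) - L)).toENNReal ∂P with hB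
  have hA' : ∫⁻ x, (f x).toENNReal ∂P = A :=
    lintegral_congr_ae (hf.mono fun x hx => by simp only [hx])
  have hB' : ∫⁻ x, (-f x).toENNReal ∂P = B :=
    lintegral_congr_ae (hf.mono fun x hx => by simp only [hx])
  have hBle : B ≤ ENNReal.ofReal L := by
    refine (lintegral_mono fun x => (hpt (h x)).2).trans ?_
    simp
  have hsum : A + ENNReal.ofReal L = (∫⁻ x, h x ∂P) + B := by
    rw [← lintegral_add_left hh, ← lintegral_congr fun x => (hpt (h x)).1,
      lintegral_add_right _ measurable_const]
    simp [A]
  rw [extIntegral, hA', hB']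
  generalize ∫⁻ x, h x ∂P = J at hsum ⊢
  have hBtop : B ≠ ⊤ := ne_top_of_le_ne_top ENNReal.ofReal_ne_top hBle
  clear_value A B
  lift B to ℝ≥0 using hBtop
  induction J with
  | top =>
    have : A = ⊤ := by simpa using hsum
    subst this
    rfl
  | coe J =>
    have : A ≠ ⊤ := by
      rintro rfl
      simp at hsum
      exact absurd hsum.symm (by simp)
    lift A to ℝ≥0 using this
    have h3 : (A : ℝ) + L = J + B := by
      have := congrArg ENNReal.toReal hsum
      rw [ENNReal.toReal_add (by simp) (by simp), ENNReal.toReal_add (by simp) (by simp),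
        ENNReal.toReal_ofReal hL] at this
      simpa using this
    change (((A : ℝ) : EReal) - ((B : ℝ) : EReal)) = ((J : ℝ) : EReal) - L
    rw [← EReal.coe_sub, ← EReal.coe_sub]
    congr 1
    linarith

variable {n : ℕ}

/-- The regularized logarithmic kernel `log⁺ (e^d / |x - y|)`. -/
noncomputable def logKernel (d : ℝ) (z : EuclideanSpace ℝ (Fin n) × EuclideanSpace ℝ (Fin n)) :
    ℝ≥0∞ := (ENNReal.log (ENNReal.ofReal (Real.exp d) * (edist z.1 z.2)⁻¹)).toENNReal

theorem continuous_logKernel (d : ℝ) : Continuous (logKernel (n := n) d) := by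
  refine EReal.continuous_toENNReal.comp (ENNReal.continuous_log.comp ?_)
  exact (ENNReal.continuous_const_mul ENNReal.ofReal_ne_top).comp
    (continuous_inv.comp (continuous_fst.edist continuous_snd))

/-- Once e^d bounds the distance, the positive part in the kernel cuts nothing off; on the diagonal
both sides vanish. -/
theorem edist_eq_exp_mul_expNeg_logKernel {d : ℝ} {x y : EuclideanSpace ℝ (Fin n)}
    (h : edist x y ≤ ENNReal.ofReal (Real.exp d)) :
    edist x y = ENNReal.ofReal (Real.exp d) * expNeg (logKernel d (x, y)) := by
  have hpos : ENNReal.ofReal (Real.exp d) ≠ 0 := by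
    simpa using Real.exp_pos d
  have h1 : (0 : EReal) ≤ ENNReal.log (ENNReal.ofReal (Real.exp d) * (edist x y)⁻¹) := by
    rw [ENNReal.zero_le_log_iff, ← div_eq_mul_inv]
    rw [ENNReal.le_div_iff_mul_le (Or.inr hpos) (Or.inl (edist_ne_top _ _)), one_mul]
    exact h
  rw [expNeg, logKernel, EReal.coe_toENNReal h1, EReal.exp_neg, ENNReal.exp_log,
    ENNReal.mul_inv (Or.inl hpos) (Or.inl ENNReal.ofReal_ne_top), inv_inv, ← mul_assoc,
    ENNReal.mul_inv_cancel hpos ENNReal.ofReal_ne_top, one_mul]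

open Classical in
/-- The external field `Q + c`, set to be `∞` off `K`. -/
noncomputable def shiftedField (K : Set (EuclideanSpace ℝ (Fin n)))
    (Q : EuclideanSpace ℝ (Fin n) → EReal) (c : ℝ) (x : EuclideanSpace ℝ (Fin n)) : ℝ≥0∞ :=
  if x ∈ K then (Q x + c).toENNReal else ⊤

/-- Finite sublevel sets are relatively closed in the closed set K. The value ∞ off K is what
extends semicontinuity to the whole space. -/
theorem lowerSemicontinuous_shiftedField {K : Set (EuclideanSpace ℝ (Fin n))} (hK : IsClosed K)
    {Q : EuclideanSpace ℝ (Fin n) → EReal} (hQ : LowerSemicontinuousOn Q K) (c : ℝ) :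
    LowerSemicontinuous (shiftedField K Q c) := by
  rw [lowerSemicontinuous_iff_isClosed_preimage]
  intro t
  by_cases ht : t = ⊤
  · simp [ht, Set.Iic_top]
  have : shiftedField K Q c ⁻¹' Set.Iic t = K ∩ Q ⁻¹' Set.Iic ((t : EReal) - c) := by
    ext x
    by_cases hx : x ∈ K
    · have h1 : (Q x + c).toENNReal ≤ t ↔ Q x + c ≤ t := by
        rw [← EReal.coe_ennreal_le_coe_ennreal_iff, EReal.coe_toENNReal_eq_max, max_le_iff]
        exact and_iff_right (EReal.coe_ennreal_nonneg t)
      simp only [Set.mem_preimage, Set.mem_Iic, shiftedField, hx, if_true, Set.mem_inter_iff,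
        true_and, h1]
      rw [EReal.le_sub_iff_add_le (by simp) (by simp)]
    · simp [shiftedField, hx, ht]
  rw [this]
  obtain ⟨u, hu, hKu⟩ := lowerSemicontinuousOn_iff_preimage_Iic.1 hQ ((t : EReal) - c)
  rw [hKu]
  exact hK.inter hu

theorem weight_eq_exp_mul_expNeg {K : Set (EuclideanSpace ℝ (Fin n))}
    {Q : EuclideanSpace ℝ (Fin n) → EReal} {c : ℝ} {x : EuclideanSpace ℝ (Fin n)} (hx : x ∈ K)
    (hc : ((-c : ℝ) : EReal) ≤ Q x) :
    weight Q x = ENNReal.ofReal (Real.exp c) * expNeg (shiftedField K Q c x) := by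
  have h1 : (0 : EReal) ≤ Q x + c := by
    have := add_le_add_left hc (c : EReal)
    rwa [← EReal.coe_add, neg_add_cancel, EReal.coe_zero] at this
  rw [weight, shiftedField, if_pos hx, expNeg, EReal.coe_toENNReal h1,
    EReal.neg_add (by simp) (by simp), sub_eq_add_neg, EReal.exp_add, EReal.exp_neg (c : EReal), mul_comm,
    mul_assoc, EReal.exp_coe, ENNReal.inv_mul_cancel (by simp [Real.exp_pos]) ENNReal.ofReal_ne_top,
    mul_one]

/-- The weighted kernel `log (1 / (|x - y| w(x) w(y)))`, shifted by a constant. -/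
noncomputable def weightedKernel (K : Set (EuclideanSpace ℝ (Fin n)))
    (Q : EuclideanSpace ℝ (Fin n) → EReal) (d c : ℝ)
    (z : EuclideanSpace ℝ (Fin n) × EuclideanSpace ℝ (Fin n)) : ℝ≥0∞ :=
  logKernel d z + (shiftedField K Q c z.1 + shiftedField K Q c z.2)

theorem weightedKernel_symm (K : Set (EuclideanSpace ℝ (Fin n)))
    (Q : EuclideanSpace ℝ (Fin n) → EReal) (d c : ℝ) (x y : EuclideanSpace ℝ (Fin n)) :
    weightedKernel K Q d c (x, y) = weightedKernel K Q d c (y, x) := by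
  simp only [weightedKernel, logKernel, edist_comm x y]
  rw [add_comm (shiftedField K Q c x)]

theorem lowerSemicontinuous_weightedKernel {K : Set (EuclideanSpace ℝ (Fin n))} (hK : IsClosed K)
    {Q : EuclideanSpace ℝ (Fin n) → EReal} (hQ : LowerSemicontinuousOn Q K) (d c : ℝ) :
    LowerSemicontinuous (weightedKernel K Q d c) := by
  have h := lowerSemicontinuous_shiftedField hK hQ c
  exact (continuous_logKernel d).lowerSemicontinuous.add
    ((LowerSemicontinuous.comp h continuous_fst).add
      (LowerSemicontinuous.comp h continuous_snd))

/-- The distance contributes the shift d and each weight a shift c. The asymptotic arguments use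
only this factorization. -/
theorem edist_mul_weight_mul_weight {K : Set (EuclideanSpace ℝ (Fin n))}
    {Q : EuclideanSpace ℝ (Fin n) → EReal} {d c : ℝ}
    (hd : ∀ x ∈ K, ∀ y ∈ K, edist x y ≤ ENNReal.ofReal (Real.exp d))
    (hc : ∀ x ∈ K, ((-c : ℝ) : EReal) ≤ Q x) {x y : EuclideanSpace ℝ (Fin n)}
    (hx : x ∈ K) (hy : y ∈ K) :
    edist x y * weight Q x * weight Q y =
      ENNReal.ofReal (Real.exp (d + 2 * c)) * expNeg (weightedKernel K Q d c (x, y)) := by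
  rw [edist_eq_exp_mul_expNeg_logKernel (hd x hx y hy), weight_eq_exp_mul_expNeg hx (hc x hx),
    weight_eq_exp_mul_expNeg hy (hc y hy), weightedKernel, expNeg_add, expNeg_add,
    show d + 2 * c = d + c + c by ring, Real.exp_add, Real.exp_add,
    ENNReal.ofReal_mul (by positivity), ENNReal.ofReal_mul (by positivity)]
  ring

theorem ae_mem_prod_of_compl_null {K : Set (EuclideanSpace ℝ (Fin n))}
    {μ : Measure (EuclideanSpace ℝ (Fin n))} [SFinite μ] (hμ : μ Kᶜ = 0) :
    ∀ᵐ z ∂(μ.prod μ), z.1 ∈ K ∧ z.2 ∈ K := by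
  have h : ∀ᵐ x ∂μ, x ∈ K := hμ
  exact (Measure.quasiMeasurePreserving_fst.ae h).and (Measure.quasiMeasurePreserving_snd.ae h)

/-- The factorization holds on K × K, which carries the product measure, so minus its logarithm can
be integrated. Minimizing the weighted energy is thereby minimizing the integral of a nonnegative
kernel. -/
theorem weightedEnergy_eq_sub {K : Set (EuclideanSpace ℝ (Fin n))} (hK : IsClosed K)
    {Q : EuclideanSpace ℝ (Fin n) → EReal} (hQ : LowerSemicontinuousOn Q K) {d c : ℝ}
    (hd0 : 0 ≤ d) (hc0 : 0 ≤ c)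
    (hd : ∀ x ∈ K, ∀ y ∈ K, edist x y ≤ ENNReal.ofReal (Real.exp d))
    (hc : ∀ x ∈ K, ((-c : ℝ) : EReal) ≤ Q x) {μ : Measure (EuclideanSpace ℝ (Fin n))}
    [IsProbabilityMeasure μ] (hμ : μ Kᶜ = 0) :
    weightedEnergy Q μ =
      ((∫⁻ z, weightedKernel K Q d c z ∂(μ.prod μ) : ℝ≥0∞) : EReal) - ((d + 2 * c : ℝ) : EReal) := by
  refine extIntegral_sub_const _ (lowerSemicontinuous_weightedKernel hK hQ d c).measurable
    (by positivity) ?_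
  filter_upwards [ae_mem_prod_of_compl_null hμ] with z hz
  rw [edist_mul_weight_mul_weight hd hc hz.1 hz.2, ENNReal.log_inv, ENNReal.log_mul_add,
    ENNReal.log_ofReal_of_pos (Real.exp_pos _), Real.log_exp, expNeg, EReal.log_exp,
    EReal.neg_add (Or.inl (EReal.coe_ne_bot _)) (Or.inl (EReal.coe_ne_top _)), sub_eq_add_neg,
    neg_neg, add_comm, sub_eq_add_neg]

theorem logEnergy_eq_sub {K : Set (EuclideanSpace ℝ (Fin n))} {d : ℝ}
    (hd0 : 0 ≤ d) (hd : ∀ x ∈ K, ∀ y ∈ K, edist x y ≤ ENNReal.ofReal (Real.exp d))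
    {μ : Measure (EuclideanSpace ℝ (Fin n))} [IsProbabilityMeasure μ] (hμ : μ Kᶜ = 0) :
    logEnergy μ = ((∫⁻ z, logKernel d z ∂(μ.prod μ) : ℝ≥0∞) : EReal) - (d : EReal) := by
  refine extIntegral_sub_const _ (continuous_logKernel d).measurable hd0 ?_
  filter_upwards [ae_mem_prod_of_compl_null hμ] with z hz
  rw [edist_eq_exp_mul_expNeg_logKernel (hd _ hz.1 _ hz.2), ENNReal.log_inv, ENNReal.log_mul_add,
    ENNReal.log_ofReal_of_pos (Real.exp_pos _), Real.log_exp, expNeg, EReal.log_exp,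
    EReal.neg_add (Or.inl (EReal.coe_ne_bot _)) (Or.inl (EReal.coe_ne_top _)), sub_eq_add_neg,
    neg_neg, add_comm, sub_eq_add_neg]

/-- For an admissible weight some probability measure on `K` has finite weighted energy. -/
theorem exists_weightedKernel_lintegral_ne_top {K : Set (EuclideanSpace ℝ (Fin n))}
    (hK : IsClosed K) {Q : EuclideanSpace ℝ (Fin n) → EReal} (hQ : IsAdmissible K Q) {d c : ℝ}
    (hd0 : 0 ≤ d) (hd : ∀ x ∈ K, ∀ y ∈ K, edist x y ≤ ENNReal.ofReal (Real.exp d)) :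
    ∃ μ : Measure (EuclideanSpace ℝ (Fin n)), IsProbabilityMeasure μ ∧ μ Kᶜ = 0 ∧
      ∫⁻ z, weightedKernel K Q d c z ∂(μ.prod μ) ≠ ⊤ := by
  have hnp := hQ.not_logPolar
  simp only [IsLogPolar, not_forall] at hnp
  obtain ⟨F, hF, -, μ, ⟨hμ, hμF⟩, hE⟩ := hnp
  have hFK : F ⊆ K := fun x hx => (hF hx).1
  have hμK : μ Kᶜ = 0 := measure_mono_null (Set.compl_subset_compl.2 hFK) hμF
  have hbm := (lowerSemicontinuous_shiftedField hK hQ.lsc c).measurable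
  have hfin : ∫⁻ z, logKernel d z ∂(μ.prod μ) ≠ ⊤ := by
    intro h
    rw [logEnergy_eq_sub hd0 hd hμK, h] at hE
    exact hE rfl
  have hb : ∀ᵐ x ∂μ, shiftedField K Q c x < ⊤ := by
    have : ∀ᵐ x ∂μ, x ∈ F := hμF
    filter_upwards [this] with x hx
    rw [shiftedField, if_pos (hFK hx), lt_top_iff_ne_top]
    exact EReal.toENNReal_ne_top_iff.2 (EReal.add_ne_top (hF hx).2.ne (EReal.coe_ne_top c))
  -- a sublevel set of the field that carries mass
  obtain ⟨m, hm⟩ : ∃ m : ℕ, μ {x | shiftedField K Q c x ≤ m} ≠ 0 := by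
    by_contra! hcon
    have h0 : μ (⋃ m : ℕ, {x | shiftedField K Q c x ≤ m}) = 0 := measure_iUnion_null hcon
    have h1 : ∀ᵐ x ∂μ, x ∈ ⋃ m : ℕ, {x | shiftedField K Q c x ≤ m} := by
      filter_upwards [hb] with x hx
      obtain ⟨m, hm⟩ := ENNReal.exists_nat_gt hx.ne
      exact Set.mem_iUnion.2 ⟨m, hm.le⟩
    have h2 : ∀ᵐ x ∂μ, x ∉ ⋃ m : ℕ, {x | shiftedField K Q c x ≤ m} :=
      measure_eq_zero_iff_ae_notMem.1 h0
    obtain ⟨x, hx1, hx2⟩ := (h1.and h2).exists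
    exact hx2 hx1
  set S := {x | shiftedField K Q c x ≤ m} with hS
  have hSm : MeasurableSet S := hbm measurableSet_Iic
  have hSinv : (μ S)⁻¹ ≠ ⊤ := ENNReal.inv_ne_top.2 hm
  have hcond : IsProbabilityMeasure ((μ S)⁻¹ • μ.restrict S) := by
    constructor
    simp [ENNReal.inv_mul_cancel hm (measure_ne_top _ _)]
  refine ⟨(μ S)⁻¹ • μ.restrict S, hcond, ?_, ?_⟩
  · have : μ.restrict S Kᶜ = 0 := Measure.absolutelyContinuous_of_le Measure.restrict_le_self hμK
    simp [this]
  · rw [Measure.prod_smul_left, Measure.prod_smul_right, Measure.prod_restrict,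
      lintegral_smul_measure, lintegral_smul_measure]
    refine ENNReal.mul_ne_top hSinv (ENNReal.mul_ne_top hSinv ?_)
    -- On S × S the two fields add at most 2m; the logarithmic part is nonnegative, so restriction
    -- does not increase its integral.
    have hle : ∫⁻ z in S ×ˢ S, weightedKernel K Q d c z ∂(μ.prod μ) ≤
        ∫⁻ z in S ×ˢ S, (logKernel d z + (m + m : ℝ≥0∞)) ∂(μ.prod μ) := by
      refine setLIntegral_mono' (hSm.prod hSm) fun z hz => ?_
      exact add_le_add le_rfl (add_le_add hz.1 hz.2)
    refine ne_top_of_le_ne_top ?_ (hle.trans (setLIntegral_le_lintegral _ _))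
    rw [lintegral_add_right _ measurable_const]
    simp [hfin]

end WeightedEnergies

/-! ### Asymptotics of weighted diameters and partition functions. -/

section WeightedDiameters

open LogPotential

theorem two_mul_numPairs_cast {k : ℕ} (hk : 2 ≤ k) :
    2 * (numPairs k : ℝ) = (k : ℝ) * ((k : ℝ) - 1) := by
  have h := congrArg (Nat.cast : ℕ → ℝ) (two_mul_numPairs k)
  push_cast [Nat.cast_sub (show 1 ≤ k by omega)] at h
  exact h

theorem numPairs_pos {k : ℕ} (hk : 2 ≤ k) : 0 < numPairs k := by
  have h := two_mul_numPairs k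
  have : 0 < k * (k - 1) := Nat.mul_pos (by omega) (by omega)
  omega

theorem two_div_eq_inv_numPairs {k : ℕ} (hk : 2 ≤ k) :
    2 / ((k : ℝ) * ((k : ℝ) - 1)) = (numPairs k : ℝ)⁻¹ := by
  rw [← two_mul_numPairs_cast hk]
  have : (numPairs k : ℝ) ≠ 0 := by exact_mod_cast (numPairs_pos hk).ne'
  field_simp

theorem one_div_eq_inv_two_mul_numPairs {k : ℕ} (hk : 2 ≤ k) :
    1 / ((k : ℝ) * ((k : ℝ) - 1)) = ((2 * numPairs k : ℕ) : ℝ)⁻¹ := by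
  rw [← two_mul_numPairs_cast hk, one_div]
  push_cast
  rfl

theorem ENNReal.pow_rpow_inv_natCast_self {m : ℕ} (hm : m ≠ 0) (t : ℝ≥0∞) :
    (t ^ m) ^ ((m : ℝ)⁻¹) = t := by
  rw [← ENNReal.rpow_natCast, ← ENNReal.rpow_mul,
    mul_inv_cancel₀ (by exact_mod_cast hm), ENNReal.rpow_one]

/-- Distinct coordinates are independent with law σ, so every pair has mean equal to the energy of
σ; the diagonal never enters. -/
theorem lintegral_pairSum {X : Type*} [MeasurableSpace X] {σ : Measure X} [IsProbabilityMeasure σ]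
    {h : X × X → ℝ≥0∞} (hh : Measurable h) (k : ℕ) :
    ∫⁻ x, pairSum h x ∂(Measure.pi fun _ : Fin k => σ) =
      numPairs k * ∫⁻ z, h z ∂(σ.prod σ) := by
  have hpair : ∀ i j : Fin k, i ≠ j →
      ∫⁻ x, h (x i, x j) ∂(Measure.pi fun _ : Fin k => σ) = ∫⁻ z, h z ∂(σ.prod σ) := by
    intro i j hij
    have hind := (ProbabilityTheory.iIndepFun_pi (μ := fun _ : Fin k => σ)
      (X := fun _ => (id : X → X)) fun _ => aemeasurable_id).indepFun hij
    have hmap := (ProbabilityTheory.indepFun_iff_map_prod_eq_prod_map_map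
      (measurable_pi_apply i).aemeasurable (measurable_pi_apply j).aemeasurable).1 hind
    have he : ∀ i : Fin k, (Measure.pi fun _ : Fin k => σ).map (fun x => x i) = σ := fun i =>
      (measurePreserving_eval (fun _ : Fin k => σ) i).map_eq
    rw [he, he] at hmap
    rw [← hmap, lintegral_map hh (by fun_prop)]
  have hm : ∀ i j : Fin k, Measurable fun x : Fin k → X => h (x i, x j) := fun i j =>
    hh.comp (by fun_prop)
  unfold pairSum numPairs
  rw [lintegral_finsetSum _ fun i _ => Finset.measurable_sum _ fun j _ => hm i j]
  push_cast
  rw [Finset.sum_mul]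
  refine Finset.sum_congr rfl fun i _ => ?_
  rw [lintegral_finsetSum _ fun j _ => hm i j, ← nsmul_eq_mul, ← Finset.sum_const]
  exact Finset.sum_congr rfl fun j hj => hpair i j (Finset.mem_Ioi.1 hj).ne

variable {n : ℕ}

theorem weightedVDM_eq {K : Set (EuclideanSpace ℝ (Fin n))}
    {Q : EuclideanSpace ℝ (Fin n) → EReal} {A : ℝ≥0∞}
    {h : EuclideanSpace ℝ (Fin n) × EuclideanSpace ℝ (Fin n) → ℝ≥0∞}
    (hfac : ∀ x ∈ K, ∀ y ∈ K, edist x y * weight Q x * weight Q y = A * expNeg (h (x, y)))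
    {k : ℕ} {x : Fin k → EuclideanSpace ℝ (Fin n)} (hx : ∀ i, x i ∈ K) :
    weightedVDM Q x = A ^ numPairs k * expNeg (pairSum h x) := by
  unfold weightedVDM pairSum numPairs
  simp_rw [hfac _ (hx _) _ (hx _), expNeg_sum, Finset.prod_mul_distrib, Finset.prod_const]
  rw [Finset.prod_pow_eq_pow_sum]

theorem weightedVDM_le_weightedDiameter_pow {K : Set (EuclideanSpace ℝ (Fin n))}
    {Q : EuclideanSpace ℝ (Fin n) → EReal} {k : ℕ} (hk : 2 ≤ k)
    {x : Fin k → EuclideanSpace ℝ (Fin n)} (hx : ∀ i, x i ∈ K) :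
    weightedVDM Q x ≤ weightedDiameter K Q k ^ numPairs k := by
  have h1 : weightedVDM Q x ^ (2 / ((k : ℝ) * ((k : ℝ) - 1))) ≤ weightedDiameter K Q k :=
    le_iSup₂_of_le x (fun i _ => hx i) le_rfl
  rw [two_div_eq_inv_numPairs hk] at h1
  have hN : (numPairs k : ℝ) ≠ 0 := by exact_mod_cast (numPairs_pos hk).ne'
  calc weightedVDM Q x = (weightedVDM Q x ^ (numPairs k : ℝ)⁻¹) ^ numPairs k := by
        rw [← ENNReal.rpow_natCast, ← ENNReal.rpow_mul, inv_mul_cancel₀ hN, ENNReal.rpow_one]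
    _ ≤ _ := pow_le_pow_left' h1 _

theorem partitionZ_le {K : Set (EuclideanSpace ℝ (Fin n))}
    {Q : EuclideanSpace ℝ (Fin n) → EReal} (hK : MeasurableSet K) {k : ℕ} (hk : 2 ≤ k)
    (ν : Measure (EuclideanSpace ℝ (Fin n))) [IsFiniteMeasure ν] :
    partitionZ K Q ν k ≤ weightedDiameter K Q k ^ (2 * numPairs k) * ν K ^ k := by
  have h1 : partitionZ K Q ν k ≤ ∫⁻ _ in Set.univ.pi fun _ : Fin k => K,
      weightedDiameter K Q k ^ (2 * numPairs k) ∂(Measure.pi fun _ : Fin k => ν) := by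
    refine setLIntegral_mono' (MeasurableSet.univ_pi fun _ => hK) fun x hx => ?_
    rw [mul_comm, pow_mul]
    exact pow_le_pow_left' (weightedVDM_le_weightedDiameter_pow hk fun i => hx i trivial) 2
  refine h1.trans_eq ?_
  simp [Measure.pi_pi]

/-- Jensen's inequality under the k-fold product of σ bounds the mean of e^{-2E} below by the
exponential of minus twice the mean pair energy E. Monotonicity in the measure then passes to ν. -/
theorem le_partitionZ {K : Set (EuclideanSpace ℝ (Fin n))}
    {Q : EuclideanSpace ℝ (Fin n) → EReal} {A : ℝ≥0∞} (hA : A ≠ ⊤)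
    {h : EuclideanSpace ℝ (Fin n) × EuclideanSpace ℝ (Fin n) → ℝ≥0∞} (hh : Measurable h)
    (hfac : ∀ x ∈ K, ∀ y ∈ K, edist x y * weight Q x * weight Q y = A * expNeg (h (x, y)))
    {σ ν : Measure (EuclideanSpace ℝ (Fin n))} [IsProbabilityMeasure σ] (hσ : σ Kᶜ = 0)
    (hσν : σ ≤ ν) (k : ℕ) :
    (A * expNeg (∫⁻ z, h z ∂(σ.prod σ))) ^ (2 * numPairs k) ≤ partitionZ K Q ν k := by
  set P := Measure.pi fun _ : Fin k => σ with hP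
  have hmemK : ∀ᵐ x ∂P, ∀ i, x i ∈ K := by
    have h0 : ∀ᵐ x ∂σ, x ∈ K := hσ
    exact eventually_all.2 fun i => (Measure.quasiMeasurePreserving_eval (fun _ => σ) i).ae h0
  have hres : P.restrict (Set.univ.pi fun _ => K) = P :=
    Measure.restrict_eq_self_of_ae_mem (hmemK.mono fun x hx i _ => hx i)
  have hmono : ∫⁻ x, weightedVDM Q x ^ 2 ∂P ≤ partitionZ K Q ν k := by
    rw [← hres]
    exact lintegral_mono' (Measure.restrict_mono le_rfl
      (Measure.pi_mono_of_le fun _ => hσν)) le_rfl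
  refine le_trans ?_ hmono
  have hpm : Measurable fun x : Fin k → EuclideanSpace ℝ (Fin n) => pairSum h x :=
    Finset.measurable_sum _ fun i _ => Finset.measurable_sum _ fun j _ => hh.comp (by fun_prop)
  have h1 : ∫⁻ x, weightedVDM Q x ^ 2 ∂P =
      A ^ (2 * numPairs k) * ∫⁻ x, expNeg (2 * pairSum h x) ∂P := by
    rw [← lintegral_const_mul' _ _ (ENNReal.pow_ne_top hA)]
    refine lintegral_congr_ae (hmemK.mono fun x hx => ?_)
    simp only [weightedVDM_eq hfac hx]
    rw [mul_pow, ← pow_mul, expNeg_pow, mul_comm (numPairs k)]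
    rfl
  have h2 := exp_neg_lintegral_le P (hpm.const_mul 2)
  rw [h1, mul_pow, expNeg_pow]
  gcongr
  refine le_trans (le_of_eq ?_) h2
  rw [lintegral_const_mul _ hpm, hP, lintegral_pairSum hh, Nat.cast_mul, Nat.cast_ofNat, mul_assoc]
  rfl

/-- The weighted diameters and the normalized partition functions converge to the exponential of
minus the minimal energy. -/
theorem tendsto_weightedDiameter_of_minimal {K : Set (EuclideanSpace ℝ (Fin n))}
    (hK : IsCompact K) {Q : EuclideanSpace ℝ (Fin n) → EReal} {A : ℝ≥0∞} (hA : A ≠ ⊤)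
    {h : EuclideanSpace ℝ (Fin n) × EuclideanSpace ℝ (Fin n) → ℝ≥0∞}
    (hh : LowerSemicontinuous h) (hsymm : ∀ x y, h (x, y) = h (y, x))
    (hfac : ∀ x ∈ K, ∀ y ∈ K, edist x y * weight Q x * weight Q y = A * expNeg (h (x, y)))
    {σ : Measure (EuclideanSpace ℝ (Fin n))} [IsProbabilityMeasure σ] (hσ : σ Kᶜ = 0)
    (hmin : ∀ μ : Measure (EuclideanSpace ℝ (Fin n)), IsProbabilityMeasure μ → μ Kᶜ = 0 →
      ∫⁻ z, h z ∂(σ.prod σ) ≤ ∫⁻ z, h z ∂(μ.prod μ)) :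
    Tendsto (weightedDiameter K Q) atTop (𝓝 (A * expNeg (∫⁻ z, h z ∂(σ.prod σ)))) := by
  have hσK : σ K = 1 := (prob_compl_eq_zero_iff hK.measurableSet).1 hσ
  set J := ∫⁻ z, h z ∂(σ.prod σ) with hJ
  let a : ℕ → ℝ≥0∞ := fun k =>
    ⨅ x ∈ Set.univ.pi fun _ : Fin k => K, pairSum h x / numPairs k
  -- The partition function of σ lies between the Jensen bound and a power of the diameter; no mass
  -- factor remains because σ has mass 1.
  have hlow : ∀ k, 2 ≤ k → A * expNeg J ≤ weightedDiameter K Q k := by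
    intro k hk
    have h1 := (le_partitionZ hA hh.measurable hfac hσ le_rfl k).trans
      (partitionZ_le hK.measurableSet hk σ)
    rw [hσK, one_pow, mul_one] at h1
    exact (ENNReal.pow_le_pow_left_iff (by have := numPairs_pos hk; omega)).1 h1
  -- Capping the minimal mean pair energy at J weakens the bound but gives an exponent that
  -- converges to J.
  have hup : ∀ k, 2 ≤ k → weightedDiameter K Q k ≤ A * expNeg (min (a k) J) := by
    intro k hk
    have hN : numPairs k ≠ 0 := (numPairs_pos hk).ne'
    refine iSup₂_le fun x hx => ?_
    have hxK : ∀ i, x i ∈ K := fun i => hx i trivial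
    have h1 : pairSum h x = numPairs k * (pairSum h x / numPairs k) := by
      rw [ENNReal.mul_div_cancel (by exact_mod_cast hN) (ENNReal.natCast_ne_top _)]
    rw [weightedVDM_eq hfac hxK, two_div_eq_inv_numPairs hk, h1, ← expNeg_pow, ← mul_pow,
      ENNReal.pow_rpow_inv_natCast_self hN]
    gcongr
    exact expNeg_antitone ((min_le_left _ _).trans (iInf₂_le x hx))
  have hlim : Tendsto (fun k => min (a k) J) atTop (𝓝 J) := by
    refine tendsto_order.2 ⟨fun b hb => ?_, fun b hb => ?_⟩
    · by_contra hcon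
      -- The infimum a k need not be attained, so the slack between b and b' is used to pick actual
      -- configurations.
      obtain ⟨b', hbb', hb'J⟩ := exists_between hb
      have hfreq : ∃ᶠ k in atTop, ∃ x : Fin k → EuclideanSpace ℝ (Fin n), (∀ i, x i ∈ K) ∧
          pairSum h x ≤ numPairs k * b' := by
        refine ((not_eventually.1 hcon).and_eventually (eventually_ge_atTop 2)).mono ?_
        rintro k ⟨hk1, hk⟩
        have h2 : a k < b' := by
          rcases min_le_iff.1 (not_lt.1 hk1) with h3 | h3
          · exact h3.trans_lt hbb'
          · exact absurd (h3.trans_lt hb) (lt_irrefl _)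
        obtain ⟨x, hx⟩ := iInf_lt_iff.1 h2
        obtain ⟨hxK, hx⟩ := iInf_lt_iff.1 hx
        refine ⟨x, fun i => hxK i trivial, ?_⟩
        rw [mul_comm]
        exact (ENNReal.div_le_iff (by exact_mod_cast (numPairs_pos hk).ne')
          (ENNReal.natCast_ne_top _)).1 hx.le
      obtain ⟨μ, h1, h2, h3⟩ := exists_energy_le_of_frequently_pairSum_le hK hh hsymm hfreq
      exact absurd ((hmin μ h1 h2).trans h3) (not_le.2 hb'J)
    · exact Eventually.of_forall fun k => (min_le_right _ _).trans_lt hb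
  have hlim2 : Tendsto (fun k => A * expNeg (min (a k) J)) atTop (𝓝 (A * expNeg J)) :=
    ENNReal.Tendsto.const_mul ((continuous_expNeg.tendsto J).comp hlim) (Or.inr hA)
  exact tendsto_of_tendsto_of_tendsto_of_le_of_le' tendsto_const_nhds hlim2
    (eventually_atTop.2 ⟨2, hlow⟩) (eventually_atTop.2 ⟨2, hup⟩)

/-- After taking roots, the total mass enters the upper bound only as ν(K)^{1/(k-1)}, which tends to
1 because ν(K) is finite and at least σ(K) = 1. -/
theorem tendsto_partitionZ_of_minimal {K : Set (EuclideanSpace ℝ (Fin n))}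
    (hK : IsCompact K) {Q : EuclideanSpace ℝ (Fin n) → EReal} {A : ℝ≥0∞} (hA : A ≠ ⊤)
    {h : EuclideanSpace ℝ (Fin n) × EuclideanSpace ℝ (Fin n) → ℝ≥0∞}
    (hh : LowerSemicontinuous h)
    (hfac : ∀ x ∈ K, ∀ y ∈ K, edist x y * weight Q x * weight Q y = A * expNeg (h (x, y)))
    {σ ν : Measure (EuclideanSpace ℝ (Fin n))} [IsProbabilityMeasure σ] [IsFiniteMeasure ν]
    (hσ : σ Kᶜ = 0) (hσν : σ ≤ ν)
    (hdiam : Tendsto (weightedDiameter K Q) atTop (𝓝 (A * expNeg (∫⁻ z, h z ∂(σ.prod σ))))) :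
    Tendsto (fun k : ℕ => partitionZ K Q ν k ^ (1 / ((k : ℝ) * ((k : ℝ) - 1)))) atTop
      (𝓝 (A * expNeg (∫⁻ z, h z ∂(σ.prod σ)))) := by
  set J := ∫⁻ z, h z ∂(σ.prod σ) with hJ
  have hνK : ν K ≠ 0 := by
    have hσK : σ K = 1 := (prob_compl_eq_zero_iff hK.measurableSet).1 hσ
    have := hσν K
    rw [hσK] at this
    exact (zero_lt_one.trans_le this).ne'
  have hlow : ∀ k, 2 ≤ k →
      A * expNeg J ≤ partitionZ K Q ν k ^ (1 / ((k : ℝ) * ((k : ℝ) - 1))) := by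
    intro k hk
    have hN : 2 * numPairs k ≠ 0 := by have := numPairs_pos hk; omega
    rw [one_div_eq_inv_two_mul_numPairs hk,
      ← ENNReal.pow_rpow_inv_natCast_self hN (A * expNeg J)]
    exact ENNReal.rpow_le_rpow (le_partitionZ hA hh.measurable hfac hσ hσν k) (by positivity)
  have hup : ∀ k : ℕ, 2 ≤ k → partitionZ K Q ν k ^ (1 / ((k : ℝ) * ((k : ℝ) - 1))) ≤
      weightedDiameter K Q k * ν K ^ (1 / ((k : ℝ) - 1)) := by
    intro k hk
    have hN : 2 * numPairs k ≠ 0 := by have := numPairs_pos hk; omega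
    have hk2 : (2 : ℝ) ≤ k := by exact_mod_cast hk
    have hpos : 0 < (k : ℝ) * ((k : ℝ) - 1) := mul_pos (by linarith) (by linarith)
    refine (ENNReal.rpow_le_rpow (partitionZ_le hK.measurableSet hk ν)
      (one_div_pos.2 hpos).le).trans ?_
    rw [ENNReal.mul_rpow_of_nonneg _ _ (one_div_pos.2 hpos).le]
    refine mul_le_mul' (le_of_eq ?_) (le_of_eq ?_)
    · rw [one_div_eq_inv_two_mul_numPairs hk, ENNReal.pow_rpow_inv_natCast_self hN]
    · rw [← ENNReal.rpow_natCast, ← ENNReal.rpow_mul]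
      congr 1
      have : (k : ℝ) ≠ 0 := by positivity
      have : (k : ℝ) - 1 ≠ 0 := by linarith
      field_simp
  have hmass : Tendsto (fun k : ℕ => ν K ^ (1 / ((k : ℝ) - 1))) atTop (𝓝 1) := by
    have h1 : Tendsto (fun k : ℕ => 1 / ((k : ℝ) - 1)) atTop (𝓝 0) :=
      tendsto_const_nhds.div_atTop
        (tendsto_atTop_add_const_right _ _ tendsto_natCast_atTop_atTop)
    have h2 : Tendsto (fun k : ℕ => ENNReal.ofReal ((ν K).toReal ^ (1 / ((k : ℝ) - 1)))) atTop
        (𝓝 (ENNReal.ofReal ((ν K).toReal ^ (0 : ℝ)))) :=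
      ENNReal.tendsto_ofReal (tendsto_const_nhds.rpow h1
        (Or.inl (ENNReal.toReal_ne_zero.2 ⟨hνK, measure_ne_top _ _⟩)))
    rw [Real.rpow_zero, ENNReal.ofReal_one] at h2
    refine h2.congr fun k => ?_
    rw [← ENNReal.ofReal_rpow_of_pos (ENNReal.toReal_pos hνK (measure_ne_top _ _)),
      ENNReal.ofReal_toReal (measure_ne_top _ _)]
  have hprod : Tendsto (fun k : ℕ => weightedDiameter K Q k * ν K ^ (1 / ((k : ℝ) - 1))) atTop
      (𝓝 (A * expNeg J * 1)) :=
    ENNReal.Tendsto.mul hdiam (Or.inr ENNReal.one_ne_top) hmass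
      (Or.inr (ENNReal.mul_ne_top hA (expNeg_ne_top _)))
  rw [mul_one] at hprod
  exact tendsto_of_tendsto_of_tendsto_of_le_of_le' tendsto_const_nhds hprod
    (eventually_atTop.2 ⟨2, hlow⟩) (eventually_atTop.2 ⟨2, hup⟩)

end WeightedDiameters

/-! ### Fekete points and a polynomial Bernstein-Markov measure. -/

section BernsteinMarkov

open LogPotential

/-- Fekete points: a compact subset of a finite-dimensional space that spans it contains a
basis in which all its elements have coordinates of absolute value at most `1`. -/
theorem exists_basis_coord_le_one {V : Type*} [NormedAddCommGroup V] [NormedSpace ℝ V]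
    [FiniteDimensional ℝ V] {S : Set V} (hS : IsCompact S) (hspan : Submodule.span ℝ S = ⊤) :
    ∃ x : Fin (Module.finrank ℝ V) → V, (∀ i, x i ∈ S) ∧
      ∀ y ∈ S, ∃ c : Fin (Module.finrank ℝ V) → ℝ, (∀ i, |c i| ≤ 1) ∧ y = ∑ i, c i • x i := by
  obtain ⟨b, hbS, hbspan, hbli⟩ := exists_linearIndependent ℝ S
  rw [hspan] at hbspan
  let B₀ : Module.Basis b ℝ V := Module.Basis.mk hbli (by rw [Subtype.range_coe, hbspan])
  have hfin : Fintype b := FiniteDimensional.fintypeBasisIndex B₀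
  let e : b ≃ Fin (Module.finrank ℝ V) :=
    Fintype.equivFinOfCardEq (Module.finrank_eq_card_basis B₀).symm
  let B := B₀.reindex e
  have hBS : ∀ i, B i ∈ S := by
    intro i
    simp only [B, Module.Basis.reindex_apply, B₀, Module.Basis.mk_apply]
    exact hbS (e.symm i).2
  have hcont : Continuous fun v : Fin (Module.finrank ℝ V) → V => B.det v := by
    simp only [Module.Basis.det_apply]
    refine Continuous.matrix_det (continuous_matrix fun i j => ?_)
    exact (LinearMap.continuous_of_finiteDimensional (B.coord i)).comp (continuous_apply j)
  have hcpt : IsCompact (Set.univ.pi fun _ : Fin (Module.finrank ℝ V) => S) :=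
    isCompact_univ_pi fun _ => hS
  -- Fekete points maximize the absolute value of the determinant over tuples in S.
  obtain ⟨x, hx, hmax⟩ := hcpt.exists_isMaxOn ⟨B, fun i _ => hBS i⟩ hcont.abs.continuousOn
  have hdet : B.det x ≠ 0 := by
    have h1 : |B.det B| ≤ |B.det x| := hmax (fun i _ => hBS i)
    rw [Module.Basis.det_self, abs_one] at h1
    intro h0
    rw [h0, abs_zero] at h1
    linarith
  obtain ⟨hli, hsp⟩ := (Module.Basis.is_basis_iff_det B).2 hdet.isUnit
  let X := Module.Basis.mk hli hsp.ge
  refine ⟨x, fun i => hx i trivial, fun y hy => ⟨fun i => X.coord i y, fun i => ?_, ?_⟩⟩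
  · have h1 := DFunLike.congr_fun (B.det_smul_mk_coord_eq_det_update hli hsp.ge i) y
    -- Cramer's rule: a coordinate is the ratio of two determinants, the maximal one being the
    -- denominator.
    have h2 : B.det x * X.coord i y = B.det (Function.update x i y) := h1
    have h3 : |B.det (Function.update x i y)| ≤ |B.det x| := by
      refine hmax fun j _ => ?_
      rcases eq_or_ne j i with rfl | hj
      · simpa using hy
      · simpa [hj] using hx j trivial
    rw [← h2, abs_mul] at h3
    have h4 : 0 < |B.det x| := abs_pos.2 hdet
    nlinarith
  · have := X.sum_repr y
    simpa [X] using this.symm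

/-- Fekete points of a compact subset of a finite-dimensional space. -/
theorem exists_points_coord_le_one {V : Type*} [NormedAddCommGroup V] [NormedSpace ℝ V]
    [FiniteDimensional ℝ V] {S : Set V} (hS : IsCompact S) :
    ∃ m ≤ Module.finrank ℝ V, ∃ x : Fin m → V, (∀ i, x i ∈ S) ∧
      ∀ y ∈ S, ∃ c : Fin m → ℝ, (∀ i, |c i| ≤ 1) ∧ y = ∑ i, c i • x i := by
  -- S need not span V: monomials become dependent on a K inside an algebraic hypersurface.
  let W := Submodule.span ℝ S
  let S' : Set W := {v | (v : V) ∈ S}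
  have hS' : IsCompact S' :=
    (W.closed_of_finiteDimensional.isClosedEmbedding_subtypeVal).isCompact_preimage hS
  have hspan : Submodule.span ℝ S' = ⊤ := Submodule.span_span_coe_preimage
  obtain ⟨x, hx, hxy⟩ := exists_basis_coord_le_one hS' hspan
  refine ⟨Module.finrank ℝ W, Submodule.finrank_le W, fun i => x i, hx, fun y hy => ?_⟩
  obtain ⟨c, hc, hyc⟩ := hxy ⟨y, Submodule.subset_span hy⟩ hy
  refine ⟨c, hc, ?_⟩
  have := congrArg (Subtype.val) hyc
  simpa using this

/-- Fekete points for polynomials of degree at most `k`: the values at polynomially many points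
control the values on the compact set. -/
theorem exists_fekete_points {n : ℕ} {K : Set (EuclideanSpace ℝ (Fin n))} (hK : IsCompact K)
    (k : ℕ) : ∃ m ≤ (k + 1) ^ n, ∃ x : Fin m → EuclideanSpace ℝ (Fin n), (∀ i, x i ∈ K) ∧
      ∀ p : MvPolynomial (Fin n) ℝ, p.totalDegree ≤ k → ∀ y ∈ K,
        |MvPolynomial.eval (fun i => y i) p| ≤ ∑ j, |MvPolynomial.eval (fun i => x j i) p| := by
  classical
  -- The box of exponents at most k contains all those of total degree at most k, and its
  -- cardinality has the simple bound (k+1)^n.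
  let s : Finset (Fin n →₀ ℕ) := Finset.Iic (Finsupp.equivFunOnFinite.symm fun _ => k)
  let mono : EuclideanSpace ℝ (Fin n) → s → ℝ := fun y d => ∏ i, y i ^ (d : Fin n →₀ ℕ) i
  have hcard : s.card ≤ (k + 1) ^ n := by
    simp only [s, Finsupp.card_Iic, Nat.card_Iic]
    refine (Finset.prod_le_prod_of_subset_of_one_le' (Finset.subset_univ _) (by simp)).trans ?_
    simp
  have hcont : Continuous mono := by fun_prop
  have heval : ∀ p : MvPolynomial (Fin n) ℝ, p.totalDegree ≤ k → ∀ y : EuclideanSpace ℝ (Fin n),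
      MvPolynomial.eval (fun i => y i) p = ∑ d : s, p.coeff d * mono y d := by
    intro p hp y
    rw [MvPolynomial.eval_eq', Finset.sum_coe_sort s fun d => p.coeff d * ∏ i, y i ^ d i]
    refine Finset.sum_subset (fun d hd => ?_) fun d _ hd => ?_
    · refine Finset.mem_Iic.2 fun i => ?_
      have h1 : d i ≤ d.degree := Finsupp.le_degree i d
      have h2 := MvPolynomial.le_totalDegree hd
      have h3 : d.degree = d.sum fun _ e => e := rfl
      simp only [Finsupp.equivFunOnFinite_symm_apply_apply]
      omega
    · rw [MvPolynomial.notMem_support_iff.1 hd, zero_mul]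
  obtain ⟨m, hm, v, hv, hvy⟩ := exists_points_coord_le_one (hK.image hcont)
  choose x hxK hxv using hv
  refine ⟨m, hm.trans (by simpa using hcard), x, hxK, fun p hp y hy => ?_⟩
  obtain ⟨c, hc, hyc⟩ := hvy (mono y) ⟨y, hy, rfl⟩
  have h1 : MvPolynomial.eval (fun i => y i) p =
      ∑ j, c j * MvPolynomial.eval (fun i => x j i) p := by
    simp_rw [heval p hp, hyc, ← hxv, Finset.sum_apply, Finset.mul_sum]
    rw [Finset.sum_comm]
    refine Finset.sum_congr rfl fun j _ => Finset.sum_congr rfl fun d _ => ?_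
    simp only [Pi.smul_apply, smul_eq_mul]
    ring
  rw [h1]
  refine (Finset.abs_sum_le_sum_abs _ _).trans (Finset.sum_le_sum fun j _ => ?_)
  rw [abs_mul]
  exact mul_le_of_le_one_left (abs_nonneg _) (hc j)

/-- A finite measure on a compact set with a polynomial Bernstein-Markov inequality. -/
theorem exists_measure_bernsteinMarkov {n : ℕ} {K : Set (EuclideanSpace ℝ (Fin n))}
    (hK : IsCompact K) : ∃ ν : Measure (EuclideanSpace ℝ (Fin n)), IsFiniteMeasure ν ∧ ν Kᶜ = 0 ∧
      ∀ k : ℕ, ∀ p : MvPolynomial (Fin n) ℝ, p.totalDegree ≤ k → ∀ y ∈ K,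
        ‖MvPolynomial.eval (fun i => y i) p‖ₑ ^ 2 ≤ ((k : ℝ≥0∞) + 1) ^ (2 * n + 2) *
          ∫⁻ x in K, ‖MvPolynomial.eval (fun i => x i) p‖ₑ ^ 2 ∂ν := by
  choose m hm x hxK hx using exists_fekete_points hK
  -- At most (k+1)^n points in degree k leave mass at most (k+1)^{-2}, which is summable.
  let c : ℕ → ℝ≥0∞ := fun k => (((k : ℝ≥0∞) + 1) ^ (n + 2))⁻¹
  let ν : Measure (EuclideanSpace ℝ (Fin n)) :=
    Measure.sum fun k => c k • ∑ i, Measure.dirac (x k i)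
  have hKm := hK.measurableSet.compl
  have hν0 : ν Kᶜ = 0 := by
    simp only [ν, Measure.sum_apply _ hKm, Measure.smul_apply, Measure.finsetSum_apply,
      Measure.dirac_apply' _ hKm]
    simp [hxK]
  have hνfin : IsFiniteMeasure ν := by
    constructor
    have h1 : ν Set.univ = ∑' k, c k * (m k : ℝ≥0∞) := by
      simp [ν, Measure.sum_apply _ MeasurableSet.univ]
    have h2 : ∀ k, c k * (m k : ℝ≥0∞) ≤ ENNReal.ofReal (1 / ((k : ℝ) + 1) ^ 2) := by
      intro k
      have h3 : (m k : ℝ≥0∞) ≤ ((k : ℝ≥0∞) + 1) ^ n := by exact_mod_cast hm k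
      have h4 : ENNReal.ofReal (1 / ((k : ℝ) + 1) ^ 2) = (((k : ℝ≥0∞) + 1) ^ 2)⁻¹ := by
        rw [one_div, ENNReal.ofReal_inv_of_pos (by positivity), ENNReal.ofReal_pow (by positivity),
          ENNReal.ofReal_add (by positivity) (by positivity)]
        simp
      rw [h4, mul_comm, ← div_eq_mul_inv]
      have h5 : ((k : ℝ≥0∞) + 1) ^ (n + 2) ≠ 0 := by positivity
      have h6 : ((k : ℝ≥0∞) + 1) ≠ ⊤ := by finiteness
      rw [ENNReal.div_le_iff h5 (ENNReal.pow_ne_top h6), pow_add, mul_comm (_ ^ n), ← mul_assoc,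
        ENNReal.inv_mul_cancel (by positivity) (ENNReal.pow_ne_top h6), one_mul]
      exact h3
    have h3 : Summable fun k : ℕ => 1 / ((k : ℝ) + 1) ^ 2 := by
      have := (summable_nat_add_iff 1).2 (Real.summable_one_div_nat_pow.2 (le_refl 2))
      simpa using this
    rw [h1]
    refine (ENNReal.tsum_le_tsum h2).trans_lt ?_
    rw [← ENNReal.ofReal_tsum_of_nonneg (fun k => by positivity) h3]
    exact ENNReal.ofReal_lt_top
  refine ⟨ν, hνfin, hν0, fun k p hp y hy => ?_⟩
  have hres : ν.restrict K = ν := Measure.restrict_eq_self_of_ae_mem hν0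
  rw [hres]
  have hmeas : Measurable fun z : EuclideanSpace ℝ (Fin n) =>
      ‖MvPolynomial.eval (fun i => z i) p‖ₑ ^ 2 := by
    have : Continuous fun z : EuclideanSpace ℝ (Fin n) => MvPolynomial.eval (fun i => z i) p :=
      (MvPolynomial.continuous_eval p).comp (by fun_prop)
    exact (this.measurable.enorm).pow_const 2
  have hint : c k * ∑ j, ‖MvPolynomial.eval (fun i => x k j i) p‖ₑ ^ 2 ≤
      ∫⁻ z, ‖MvPolynomial.eval (fun i => z i) p‖ₑ ^ 2 ∂ν := by
    have h1 : c k • ∑ i, Measure.dirac (x k i) ≤ ν :=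
      Measure.le_sum (fun k => c k • ∑ i, Measure.dirac (x k i)) k
    refine le_trans (le_of_eq ?_) (lintegral_mono' h1 le_rfl)
    simp only [lintegral_smul_measure, lintegral_finsetSum_measure, lintegral_dirac' _ hmeas,
      smul_eq_mul]
  -- Cauchy-Schwarz costs the number of points, at most (k+1)^n; undoing the weight costs
  -- (k+1)^{n+2}, whence the exponent 2n+2.
  have hcs : ‖MvPolynomial.eval (fun i => y i) p‖ₑ ^ 2 ≤
      m k * ∑ j, ‖MvPolynomial.eval (fun i => x k j i) p‖ₑ ^ 2 := by
    have h1 : (MvPolynomial.eval (fun i => y i) p) ^ 2 ≤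
        m k * ∑ j, (MvPolynomial.eval (fun i => x k j i) p) ^ 2 := by
      rw [← sq_abs]
      refine (pow_le_pow_left₀ (abs_nonneg _) (hx k p hp y hy) 2).trans ?_
      have := sq_sum_le_card_mul_sum_sq (s := Finset.univ)
        (f := fun j => |MvPolynomial.eval (fun i => x k j i) p|)
      simpa [sq_abs] using this
    have h2 : ∀ r : ℝ, ‖r‖ₑ ^ 2 = ENNReal.ofReal (r ^ 2) := fun r => by
      rw [← enorm_pow, Real.enorm_of_nonneg (sq_nonneg r)]
    simp_rw [h2]
    rw [← ENNReal.ofReal_sum_of_nonneg fun _ _ => sq_nonneg _, ← ENNReal.ofReal_natCast,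
      ← ENNReal.ofReal_mul (by positivity)]
    exact ENNReal.ofReal_le_ofReal h1
  have hck : ((k : ℝ≥0∞) + 1) ^ (n + 2) * c k = 1 :=
    ENNReal.mul_inv_cancel (by positivity) (ENNReal.pow_ne_top (by finiteness))
  calc _ ≤ m k * ∑ j, ‖MvPolynomial.eval (fun i => x k j i) p‖ₑ ^ 2 := hcs
    _ = m k * (((k : ℝ≥0∞) + 1) ^ (n + 2) * c k) *
        ∑ j, ‖MvPolynomial.eval (fun i => x k j i) p‖ₑ ^ 2 := by rw [hck, mul_one]
    _ = m k * ((k : ℝ≥0∞) + 1) ^ (n + 2) *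
        (c k * ∑ j, ‖MvPolynomial.eval (fun i => x k j i) p‖ₑ ^ 2) := by ring
    _ ≤ ((k : ℝ≥0∞) + 1) ^ n * ((k : ℝ≥0∞) + 1) ^ (n + 2) *
        ∫⁻ z, ‖MvPolynomial.eval (fun i => z i) p‖ₑ ^ 2 ∂ν := by
      gcongr
      exact_mod_cast hm k
    _ = _ := by rw [← pow_add]; congr 2; ring

end BernsteinMarkov

/-! ### From polynomial to weighted Bernstein-Markov inequalities. -/

section StrongBernsteinMarkov

open LogPotential

/-- Multiplicative polynomial approximation of positive continuous functions. -/
theorem exists_mvPolynomial_approx {n : ℕ} {K : Set (EuclideanSpace ℝ (Fin n))}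
    (hK : IsCompact K) {g : EuclideanSpace ℝ (Fin n) → ℝ} (hg : ContinuousOn g K)
    (hpos : ∀ x ∈ K, 0 < g x) {ε : ℝ} (hε : 0 < ε) :
    ∃ f : MvPolynomial (Fin n) ℝ, ∀ x ∈ K, g x ≤ MvPolynomial.eval (fun i => x i) f ∧
      MvPolynomial.eval (fun i => x i) f ≤ (1 + ε) * g x := by
  rcases K.eq_empty_or_nonempty with rfl | hne
  · exact ⟨0, by simp⟩
  obtain ⟨x₀, hx₀, hmin⟩ := hK.exists_isMinOn hne hg
  have hcs : CompactSpace K := isCompact_iff_compactSpace.1 hK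
  let coordMap : Fin n → C(K, ℝ) := fun i => ⟨fun x => (x : EuclideanSpace ℝ (Fin n)) i, by fun_prop⟩
  let Alg := (MvPolynomial.aeval (R := ℝ) coordMap).range
  have hsep : Alg.SeparatesPoints := by
    intro x y hxy
    obtain ⟨i, hi⟩ : ∃ i, (x : EuclideanSpace ℝ (Fin n)) i ≠ (y : EuclideanSpace ℝ (Fin n)) i := by
      by_contra! hcon
      exact hxy (Subtype.ext (PiLp.ext hcon))
    exact ⟨coordMap i, ⟨coordMap i, ⟨MvPolynomial.X i, by simp⟩, rfl⟩, hi⟩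
  -- Approximating (1+ε/2)g within (ε/2) min g keeps the polynomial between g and (1+ε)g.
  let G : C(K, ℝ) := ⟨fun x => (1 + ε / 2) * g x, continuous_const.mul hg.domRestrict⟩
  have hδ : 0 < ε / 2 * g x₀ := mul_pos (by positivity) (hpos x₀ hx₀)
  obtain ⟨⟨_, f, rfl⟩, hfG⟩ :=
    ContinuousMap.exists_mem_subalgebra_near_continuousMap_of_separatesPoints Alg hsep G _ hδ
  refine ⟨f, fun x hx => ?_⟩
  have hev : ∀ z : K, (MvPolynomial.aeval coordMap f) z =
      MvPolynomial.eval (fun i => (z : EuclideanSpace ℝ (Fin n)) i) f := by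
    intro z
    have h1 := MvPolynomial.map_aeval (R := ℝ) coordMap
      (ContinuousMap.evalAlgHom ℝ ℝ z : C(K, ℝ) →+* ℝ) f
    refine h1.trans ?_
    rfl
  have h2 := (ContinuousMap.norm_coe_le_norm _ (⟨x, hx⟩ : K)).trans_lt hfG
  rw [ContinuousMap.sub_apply] at h2
  change ‖(MvPolynomial.aeval coordMap f) ⟨x, hx⟩ - (1 + ε / 2) * g x‖ < _ at h2
  rw [hev, Real.norm_eq_abs, abs_lt] at h2
  have h3 : g x₀ ≤ g x := hmin hx
  constructor <;> nlinarith [h2.1, h2.2]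

theorem weight_coe_pow_mul {n : ℕ} (q : EuclideanSpace ℝ (Fin n) → ℝ)
    (x : EuclideanSpace ℝ (Fin n)) (k : ℕ) (r : ℝ) :
    weight (fun x => (q x : EReal)) x ^ k * ‖r‖ₑ = ‖Real.exp (-q x) ^ k * r‖ₑ := by
  rw [weight, ← EReal.coe_neg, EReal.exp_coe, enorm_mul, enorm_pow,
    Real.enorm_of_nonneg (Real.exp_pos _).le]

/-- In `ℝⁿ` a polynomial Bernstein-Markov inequality gives weighted ones, with constants of any
exponential growth rate larger than `1`. -/
theorem weighted_bernsteinMarkov_of_polynomial {n N : ℕ} {K : Set (EuclideanSpace ℝ (Fin n))}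
    (hK : IsCompact K) {ν : Measure (EuclideanSpace ℝ (Fin n))}
    (hν : ∀ k : ℕ, ∀ p : MvPolynomial (Fin n) ℝ, p.totalDegree ≤ k → ∀ y ∈ K,
        ‖MvPolynomial.eval (fun i => y i) p‖ₑ ^ 2 ≤ ((k : ℝ≥0∞) + 1) ^ (2 * N) *
          ∫⁻ x in K, ‖MvPolynomial.eval (fun i => x i) p‖ₑ ^ 2 ∂ν)
    {q : EuclideanSpace ℝ (Fin n) → ℝ} (hq : ContinuousOn q K) {ε : ℝ≥0} (hε : 0 < ε) :
    ∃ D : ℕ, ∀ k : ℕ, ∀ p : MvPolynomial (Fin n) ℝ, p.totalDegree ≤ k →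
      (⨆ x ∈ K, weight (fun x => (q x : EReal)) x ^ k * ‖MvPolynomial.eval (fun i => x i) p‖ₑ) ≤
        (((k * D + 1 : ℝ≥0) ^ N * (1 + ε) ^ k : ℝ≥0) : ℝ≥0∞) *
        (∫⁻ x in K, (weight (fun x => (q x : EReal)) x ^ k *
          ‖MvPolynomial.eval (fun i => x i) p‖ₑ) ^ 2 ∂ν) ^ (1 / 2 : ℝ) := by
  obtain ⟨f, hf⟩ := exists_mvPolynomial_approx hK (g := fun x => Real.exp (-q x))
    hq.neg.rexp (fun x _ => Real.exp_pos _) (show (0 : ℝ) < ε from hε)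
  -- The degree of f^k p is at most k deg f + k.
  refine ⟨f.totalDegree + 1, fun k p hp => iSup₂_le fun y hy => ?_⟩
  set D := f.totalDegree + 1
  have hdeg : (f ^ k * p).totalDegree ≤ k * D := by
    refine (MvPolynomial.totalDegree_mul _ _).trans ?_
    have := MvPolynomial.totalDegree_pow f k
    simp only [D, mul_add, mul_one]
    omega
  have hsq := hν _ _ hdeg y hy
  simp_rw [weight_coe_pow_mul]
  set I := ∫⁻ x in K, ‖Real.exp (-q x) ^ k * MvPolynomial.eval (fun i => x i) p‖ₑ ^ 2 ∂ν
  have hI : ∫⁻ x in K, ‖MvPolynomial.eval (fun i => x i) (f ^ k * p)‖ₑ ^ 2 ∂ν ≤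
      ((1 + ε : ℝ≥0) : ℝ≥0∞) ^ (2 * k) * I := by
    rw [← lintegral_const_mul' _ _ (ENNReal.pow_ne_top ENNReal.coe_ne_top)]
    refine setLIntegral_mono' hK.measurableSet fun x hx => ?_
    have h1 : ((1 + ε : ℝ≥0) : ℝ≥0∞) = ‖(1 + ε : ℝ)‖ₑ := by
      rw [Real.enorm_of_nonneg (by positivity), ← ENNReal.ofReal_coe_nnreal]
      simp
    rw [h1, mul_comm 2 k, pow_mul, ← mul_pow]
    refine pow_le_pow_left' ?_ 2
    rw [← enorm_pow, ← enorm_mul, enorm_le_iff_norm_le, map_mul, map_pow, norm_mul, ← mul_assoc,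
      norm_mul, ← mul_pow]
    refine mul_le_mul_of_nonneg_right ?_ (norm_nonneg _)
    rw [norm_pow, norm_pow]
    have h0 : 0 ≤ MvPolynomial.eval (fun i => x i) f := (Real.exp_pos _).le.trans (hf x hx).1
    refine pow_le_pow_left₀ (norm_nonneg _) ?_ k
    rw [Real.norm_of_nonneg h0, Real.norm_of_nonneg (by positivity)]
    exact (hf x hx).2
  have hle : ‖Real.exp (-q y) ^ k * MvPolynomial.eval (fun i => y i) p‖ₑ ≤
      ‖MvPolynomial.eval (fun i => y i) (f ^ k * p)‖ₑ := by
    rw [enorm_le_iff_norm_le, map_mul, map_pow, norm_mul, norm_mul, norm_pow, norm_pow]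
    refine mul_le_mul_of_nonneg_right (pow_le_pow_left₀ (norm_nonneg _) ?_ k) (norm_nonneg _)
    have h0 := Real.exp_pos (-q y)
    rw [Real.norm_of_nonneg h0.le, Real.norm_of_nonneg (h0.le.trans (hf y hy).1)]
    exact (hf y hy).1
  have htot : ‖Real.exp (-q y) ^ k * MvPolynomial.eval (fun i => y i) p‖ₑ ^ 2 ≤
      ((((k * D + 1 : ℝ≥0) ^ N * (1 + ε) ^ k : ℝ≥0) : ℝ≥0∞)) ^ 2 * I := by
    refine (pow_le_pow_left' hle 2).trans (hsq.trans ((mul_le_mul_right hI _).trans_eq ?_))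
    push_cast
    ring
  have hroot := ENNReal.rpow_le_rpow htot (show (0 : ℝ) ≤ 1 / 2 by norm_num)
  rw [ENNReal.mul_rpow_of_nonneg _ _ (by norm_num)] at hroot
  have hs : ∀ t : ℝ≥0∞, (t ^ 2) ^ (1 / 2 : ℝ) = t := fun t => by
    rw [← ENNReal.rpow_natCast, ← ENNReal.rpow_mul]; norm_num
  rwa [hs, hs] at hroot

/-- If for every `ε` a property of constants holds for constants of growth rate `1 + ε`, it holds
for constants of growth rate `1`. -/
theorem exists_constants_growth_one {P : ℕ → ℝ≥0 → Prop}
    (hmono : ∀ k a b, a ≤ b → P k a → P k b) {N : ℕ}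
    (h : ∀ ε : ℝ≥0, 0 < ε → ∃ D : ℕ, ∀ k : ℕ, P k ((k * D + 1 : ℝ≥0) ^ N * (1 + ε) ^ k)) :
    ∃ M : ℕ → ℝ≥0, Tendsto (fun k : ℕ => (M k : ℝ≥0∞) ^ (1 / (k : ℝ))) atTop (𝓝 1) ∧
      ∀ k, P k (M k) := by
  -- Since D depends on ε, constants are chosen independently of ε: within a factor 2 of the infimum
  -- of the valid constants that are at least 1. The bound 1 keeps the infimum positive and the
  -- roots at least 1.
  have hex : ∀ k, ∃ M : ℝ≥0, 1 ≤ M ∧ P k M ∧ ∀ M', 1 ≤ M' → P k M' → M ≤ 2 * M' := by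
    intro k
    let S : Set ℝ≥0 := {M | 1 ≤ M ∧ P k M}
    have hSne : S.Nonempty := by
      obtain ⟨D, hD⟩ := h 1 one_pos
      exact ⟨_, le_max_left 1 _, hmono k _ _ (le_max_right 1 _) (hD k)⟩
    have hS1 : 1 ≤ sInf S := le_csInf hSne fun M hM => hM.1
    obtain ⟨M, hM, hM2⟩ := exists_lt_of_csInf_lt hSne
      (show sInf S < 2 * sInf S from lt_mul_of_one_lt_left (by positivity) one_lt_two)
    refine ⟨M, hM.1, hM.2, fun M' h1 h2 => hM2.le.trans ?_⟩
    gcongr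
    exact csInf_le (OrderBot.bddBelow S) ⟨h1, h2⟩
  choose M hM1 hMP hMmin using hex
  refine ⟨M, ?_, hMP⟩
  -- For fixed D the factor 2 and the polynomial factor disappear in the k-th root, leaving 1+ε.
  have hpoly : ∀ D : ℕ, Tendsto (fun k : ℕ => ((2 : ℝ) * (D + 1) ^ N) ^ (1 / (k : ℝ)) *
      ((k : ℝ) ^ (1 / (k : ℝ))) ^ N) atTop (𝓝 1) := by
    intro D
    have h1 : Tendsto (fun k : ℕ => 1 / (k : ℝ)) atTop (𝓝 0) :=
      tendsto_one_div_atTop_nhds_zero_nat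
    have h2 : Tendsto (fun k : ℕ => ((2 : ℝ) * (D + 1) ^ N) ^ (1 / (k : ℝ))) atTop (𝓝 1) := by
      have := (tendsto_const_nhds (x := (2 : ℝ) * (D + 1) ^ N)).rpow h1
        (Or.inl (by positivity))
      rwa [Real.rpow_zero] at this
    have h3 := (tendsto_rpow_div.comp tendsto_natCast_atTop_atTop).pow N
    simpa using h2.mul h3
  have hreal : Tendsto (fun k : ℕ => (M k : ℝ) ^ (1 / (k : ℝ))) atTop (𝓝 1) := by
    refine tendsto_order.2 ⟨fun b hb => ?_, fun b hb => ?_⟩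
    · exact Eventually.of_forall fun k =>
        hb.trans_le (Real.one_le_rpow (by exact_mod_cast hM1 k) (by positivity))
    · obtain ⟨ε, hε, hεb⟩ : ∃ ε : ℝ≥0, 0 < ε ∧ (1 + (ε : ℝ)) < b :=
        ⟨Real.toNNReal ((b - 1) / 2), Real.toNNReal_pos.2 (by linarith), by
          rw [Real.coe_toNNReal _ (by linarith)]; linarith⟩
      obtain ⟨D, hD⟩ := h ε hε
      have hl := (hpoly D).mul (tendsto_const_nhds (x := 1 + (ε : ℝ)))
      rw [one_mul] at hl
      filter_upwards [hl.eventually_lt_const hεb, eventually_ge_atTop 1] with k hk hk1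
      refine lt_of_le_of_lt ?_ hk
      have hge1 : (1 : ℝ≥0) ≤ (k * D + 1 : ℝ≥0) ^ N * (1 + ε) ^ k :=
        one_le_mul (one_le_pow₀ (by simp)) (one_le_pow₀ (by simp))
      have hMk := hMmin k _ hge1 (hD k)
      have hk1' : (1 : ℝ) ≤ k := by exact_mod_cast hk1
      have hk0 : (k : ℝ) ≠ 0 := by positivity
      have hMk' : (M k : ℝ) ≤ 2 * ((k * D + 1 : ℝ) ^ N * (1 + ε) ^ k) := by exact_mod_cast hMk
      have hle : (M k : ℝ) ≤ (2 * (D + 1 : ℝ) ^ N) * (k : ℝ) ^ N * (1 + ε) ^ k := by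
        refine hMk'.trans ?_
        have h1 : (k * D + 1 : ℝ) ≤ (D + 1) * k := by nlinarith
        calc _ ≤ 2 * (((D + 1) * k : ℝ) ^ N * (1 + ε) ^ k) := by gcongr
          _ = _ := by rw [mul_pow]; ring
      calc (M k : ℝ) ^ (1 / (k : ℝ)) ≤
            ((2 * (D + 1 : ℝ) ^ N) * (k : ℝ) ^ N * (1 + ε) ^ k) ^ (1 / (k : ℝ)) := by gcongr
        _ = _ := by
          rw [Real.mul_rpow (by positivity) (by positivity),
            Real.mul_rpow (by positivity) (by positivity)]
          congr 1
          · congr 1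
            rw [← Real.rpow_natCast, ← Real.rpow_mul (by positivity), mul_comm,
              Real.rpow_mul (by positivity), Real.rpow_natCast]
          · rw [← Real.rpow_natCast, ← Real.rpow_mul (by positivity), mul_one_div_cancel hk0,
              Real.rpow_one]
  have := ENNReal.tendsto_ofReal hreal
  rw [ENNReal.ofReal_one] at this
  refine this.congr fun k => ?_
  rw [← ENNReal.ofReal_rpow_of_nonneg (by positivity) (by positivity), ENNReal.ofReal_coe_nnreal]

theorem isStrongBernsteinMarkov_of_polynomial {n N : ℕ} {K : Set (EuclideanSpace ℝ (Fin n))}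
    (hK : IsCompact K) {ν : Measure (EuclideanSpace ℝ (Fin n))} [hfin : IsFiniteMeasure ν]
    (hνK : ν Kᶜ = 0)
    (hν : ∀ k : ℕ, ∀ p : MvPolynomial (Fin n) ℝ, p.totalDegree ≤ k → ∀ y ∈ K,
        ‖MvPolynomial.eval (fun i => y i) p‖ₑ ^ 2 ≤ ((k : ℝ≥0∞) + 1) ^ (2 * N) *
          ∫⁻ x in K, ‖MvPolynomial.eval (fun i => x i) p‖ₑ ^ 2 ∂ν) :
    IsStrongBernsteinMarkov K ν where
  finite := hfin
  carried := hνK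
  bernsteinMarkov q hq := by
    obtain ⟨M, hM, hMP⟩ := exists_constants_growth_one (N := N)
      (P := fun k M => ∀ p : MvPolynomial (Fin n) ℝ, p.totalDegree ≤ k →
        (⨆ x ∈ K, weight (fun x => (q x : EReal)) x ^ k *
            ‖MvPolynomial.eval (fun i => x i) p‖ₑ) ≤
          M * (∫⁻ x in K, (weight (fun x => (q x : EReal)) x ^ k *
            ‖MvPolynomial.eval (fun i => x i) p‖ₑ) ^ 2 ∂ν) ^ (1 / 2 : ℝ))
      (fun k a b hab h p hp => (h p hp).trans (by gcongr))
      (fun ε hε => weighted_bernsteinMarkov_of_polynomial hK hν hq hε)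
    exact ⟨M, hM.limsup_eq, fun k _ => hMP k⟩

end StrongBernsteinMarkov

/-! ### Assembly of the theorem. -/

open LogPotential in
theorem proposition4p7 {n : ℕ} (K : Set (EuclideanSpace ℝ (Fin n))) (hK : IsCompact K)
    (hKpolar : ¬ LogPotential.IsLogPolar K) (Q : EuclideanSpace ℝ (Fin n) → EReal)
    (hQ : LogPotential.IsAdmissible K Q) :
    LogPotential.minEnergy K Q ≠ ⊥ ∧ LogPotential.minEnergy K Q ≠ ⊤ ∧
    Tendsto (fun k : ℕ => LogPotential.weightedDiameter K Q k) atTop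
      (𝓝 (EReal.exp (-LogPotential.minEnergy K Q))) ∧
    ∃ μ : Measure (EuclideanSpace ℝ (Fin n)), IsFiniteMeasure μ ∧ μ Kᶜ = 0 ∧
      Tendsto (fun k : ℕ =>
          LogPotential.partitionZ K Q μ k ^ (1 / ((k : ℝ) * ((k : ℝ) - 1)))) atTop
        (𝓝 (EReal.exp (-LogPotential.minEnergy K Q))) ∧
      LogPotential.IsStrongBernsteinMarkov K μ := by
  have hne : K.Nonempty := by
    rw [Set.nonempty_iff_ne_empty]
    rintro rfl
    refine hKpolar fun F hF _ μ hμ => ?_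
    have hprob := hμ.1
    have h1 := hμ.2
    rw [Set.subset_empty_iff.1 hF, Set.compl_empty, measure_univ] at h1
    exact absurd h1 one_ne_zero
  obtain ⟨d, hd0, hd⟩ : ∃ d : ℝ, 0 ≤ d ∧
      ∀ x ∈ K, ∀ y ∈ K, edist x y ≤ ENNReal.ofReal (Real.exp d) := by
    refine ⟨Metric.diam K, Metric.diam_nonneg, fun x hx y hy => ?_⟩
    rw [edist_dist]
    refine ENNReal.ofReal_le_ofReal ((Metric.dist_le_diam_of_mem hK.isBounded hx hy).trans ?_)
    linarith [Real.add_one_le_exp (Metric.diam K)]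
  -- A lower semicontinuous Q attains its minimum on K; c is made nonnegative so that the total
  -- shift is too.
  obtain ⟨c, hc0, hc⟩ : ∃ c : ℝ, 0 ≤ c ∧ ∀ x ∈ K, ((-c : ℝ) : EReal) ≤ Q x := by
    obtain ⟨x₀, hx₀, hmin⟩ := hQ.lsc.exists_isMinOn hne hK
    obtain ⟨r, -, hr⟩ := EReal.lt_iff_exists_real_btwn.1 (bot_lt_iff_ne_bot.2 (hQ.ne_bot x₀ hx₀))
    refine ⟨max (-r) 0, le_max_right _ _, fun x hx => le_trans ?_ (hr.le.trans (hmin hx))⟩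
    rw [EReal.coe_le_coe_iff]
    linarith [le_max_left (-r) 0]
  set h := weightedKernel K Q d c
  set A := ENNReal.ofReal (Real.exp (d + 2 * c))
  have hA : A ≠ ⊤ := ENNReal.ofReal_ne_top
  have hh : LowerSemicontinuous h := lowerSemicontinuous_weightedKernel hK.isClosed hQ.lsc d c
  have hfac : ∀ x ∈ K, ∀ y ∈ K, edist x y * weight Q x * weight Q y = A * expNeg (h (x, y)) :=
    fun x hx y hy => edist_mul_weight_mul_weight hd hc hx hy
  obtain ⟨σ, hσ, hσK, hmin⟩ := exists_minimal_energy hK hne hh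
  obtain ⟨μ₀, hμ₀, hμ₀K, hμ₀fin⟩ := exists_weightedKernel_lintegral_ne_top hK.isClosed hQ (c := c)
    hd0 hd
  have hJfin : ∫⁻ z, h z ∂(σ.prod σ) ≠ ⊤ := ne_top_of_le_ne_top hμ₀fin (hmin μ₀ hμ₀ hμ₀K)
  have hV : minEnergy K Q = ((∫⁻ z, h z ∂(σ.prod σ) : ℝ≥0∞) : EReal) - ((d + 2 * c : ℝ) : EReal) := by
    refine le_antisymm ?_ ?_
    · rw [← weightedEnergy_eq_sub hK.isClosed hQ.lsc hd0 hc0 hd hc hσK]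
      exact iInf₂_le σ ⟨hσ, hσK⟩
    · refine le_iInf₂ fun μ hμ => ?_
      have hprob := hμ.1
      rw [weightedEnergy_eq_sub hK.isClosed hQ.lsc hd0 hc0 hd hc hμ.2]
      exact EReal.sub_le_sub (by exact_mod_cast hmin μ hμ.1 hμ.2) le_rfl
  have hexp : EReal.exp (-minEnergy K Q) = A * expNeg (∫⁻ z, h z ∂(σ.prod σ)) := by
    rw [hV, EReal.neg_sub (Or.inr (EReal.coe_ne_bot _)) (Or.inr (EReal.coe_ne_top _)), add_comm,
      EReal.exp_add, EReal.exp_coe]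
    rfl
  have hdiam := tendsto_weightedDiameter_of_minimal hK hA hh (weightedKernel_symm K Q d c) hfac hσK
    hmin
  obtain ⟨ν, hν, hνK, hνBM⟩ := exists_measure_bernsteinMarkov hK
  -- In σ + ν, the summand σ yields the asymptotics and ν the Bernstein-Markov inequality, whose
  -- right side only grows when σ is added.
  refine ⟨?_, ?_, by rw [hexp]; exact hdiam, σ + ν, inferInstance, by simp [hσK, hνK], ?_, ?_⟩
  · generalize ∫⁻ z, h z ∂(σ.prod σ) = J at hV hJfin
    lift J to ℝ≥0 using hJfin
    rw [hV]
    exact EReal.coe_ne_bot ((J : ℝ) - (d + 2 * c))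
  · generalize ∫⁻ z, h z ∂(σ.prod σ) = J at hV hJfin
    lift J to ℝ≥0 using hJfin
    rw [hV]
    exact EReal.coe_ne_top ((J : ℝ) - (d + 2 * c))
  · rw [hexp]
    exact tendsto_partitionZ_of_minimal hK hA hh hfac hσK (Measure.le_add_right le_rfl) hdiam
  · refine isStrongBernsteinMarkov_of_polynomial hK (N := n + 1) (by simp [hσK, hνK])
      fun k p hp y hy => (hνBM k p hp y hy).trans ?_
    rw [mul_add, mul_one]
    gcongr
    exact Measure.le_add_left le_rfl
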